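/- Conventions. For an abelian category $\mathcal{C}$ let $\overline{\mathcal{C}}$ be the quotient of $\mathcal{C}$ by the ideal of morphisms factoring through injective objects; for an exact category $\mathcal{E}$ let $\overline{\mathcal{E}}$ be the quotient by the ideal of morphisms factoring through objects that are injective for the exact structure. A functor is an epivalence if it is full, dense and reflects isomorphisms. An abelian category is hereditary if for every short exact sequence $0\to N\to I\to K\to 0$ with $I$ injective, $K$ is injective. (1) Let $Q$ be a finite acyclic quiver and $\mathcal{B}$ an abelian category with enough injectives. Let $\operatorname{rep}(Q,\mathcal{B})$ be the category of representations of $Q$ in $\mathcal{B}$ (functors from the path category of $Q$ to $\mathcal{B}$), and let $\operatorname{mono}(Q,\mathcal{B})$ be its full subcategory of those representations $(B_i,B_\alpha)$ for which the map $\bigoplus_{\alpha,\,t(\alpha)=i}B_{s(\alpha)}\to B_i$ with components $B_\alpha$ is a monomorphism for each vertex $i$, with the exact structure whose conflations are the short exact sequences of $\operatorname{rep}(Q,\mathcal{B})$ with all terms in $\operatorname{mono}(Q,\mathcal{B})$. Then the functor $\operatorname{mono}(Q,\mathcal{B})\to\operatorname{rep}(Q,\overline{\mathcal{B}})$ given by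 composition with $\mathcal{B}\to\overline{\mathcal{B}}$ induces a well-defined functor $\overline{\operatorname{mono}}(Q,\mathcal{B})\to\operatorname{rep}(Q,\overline{\mathcal{B}})$, and this functor is an epivalence. If $Q$ has at least one arrow, it is an equivalence if and only if $\mathcal{B}$ is hereditary. (2) Let $\mathcal{C}$ be an abelian category with enough injectives and $X\colon\mathcal{C}\to\mathcal{C}$ an exact functor which preserves injective objects and is locally nilpotent (for each object $M$ there is $n\ge 0$ with $X^n(M)=0$). Let $T(X)$ be the free monad of $X$, with $T(X)(M)=\coprod_{i\ge0}X^i(M)$, unit the inclusion of $M=X^0(M)$, and multiplication given by the identifications $X^iX^j(M)\cong X^{i+j}(M)$. It preserves injective objects, so it induces a monad on $\overline{\mathcal{C}}$, also denoted $T(X)$. Write $\mathcal{C}^{T(X)}$ and $\overline{\mathcal{C}}{}^{T(X)}$ for the Eilenberg--Moore categories. Let $\operatorname{Mono}(X)$ be the full subcategory of $\mathcal{C}^{T(X)}$ of those modules $T(X)(M)\to M$ whose restriction $X(M)\to M$ is a monomorphism, with the exact structure whose conflations are the short exact sequences of $\mathcal{C}^{T(X)}$ with all terms in $\operatorname{Mono}(X)$.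 Then the functor $\operatorname{Mono}(X)\to\overline{\mathcal{C}}{}^{T(X)}$ given by applying $\mathcal{C}\to\overline{\mathcal{C}}$ to objects, structure maps and morphisms induces a well-defined functor $\overline{\operatorname{Mono}}(X)\to\overline{\mathcal{C}}{}^{T(X)}$, and this functor is an epivalence. It is an equivalence if and only if $X(M)$ has injective dimension at most $1$ for every object $M$ of $\mathcal{C}$; in particular it is an equivalence if $\mathcal{C}$ is hereditary. -/

import Mathlib

open CategoryTheory CategoryTheory.Limits

universe v u v₁ u₁

noncomputable section

namespace StableMono

/-! ### Quotients by ideals of morphisms -/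

section Ideals

variable {A : Type u} [Category.{v} A] [Preadditive A]

/-- Two parallel morphisms are related if their difference factors through an object of `J`. -/
def factorRel (J : ObjectProperty A) : HomRel A := fun X Y f g =>
  ∃ (Z : A) (_ : J Z) (a : X ⟶ Z) (b : Z ⟶ Y), f - g = a ≫ b

/-- The quotient of the category `A` by the ideal of morphisms factoring through objects of `J`. -/
abbrev QuotientBy (J : ObjectProperty A) := CategoryTheory.Quotient (factorRel J)

/-- The quotient functor `A ⥤ A / J`. -/
abbrev toQuotient (J : ObjectProperty A) : A ⥤ QuotientBy J :=
  CategoryTheory.Quotient.functor (factorRel J)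

/-- The functor `F` on `A` is well defined on the quotient `A / J`. -/
def Descends {D : Type u₁} [Category.{v₁} D] (J : ObjectProperty A) (F : A ⥤ D) : Prop :=
  ∀ (X Y : A) (f g : X ⟶ Y), factorRel J f g → F.map f = F.map g

/-- The functor `A / J ⥤ D` induced by a functor `F : A ⥤ D` that is well defined on `A / J`. -/
abbrev descend {D : Type u₁} [Category.{v₁} D] {J : ObjectProperty A} {F : A ⥤ D}
    (h : Descends J F) : QuotientBy J ⥤ D :=
  CategoryTheory.Quotient.lift (factorRel J) F h

theorem descends_endo (J : ObjectProperty A) (F : A ⥤ A) [F.Additive]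
    (hF : ∀ Z, J Z → J (F.obj Z)) : Descends J (F ⋙ toQuotient J) := by
  rintro X Y f g ⟨Z, hZ, a, b, h⟩
  refine CategoryTheory.Quotient.sound _ ⟨F.obj Z, hF Z hZ, F.map a, F.map b, ?_⟩
  rw [← F.map_sub, h, F.map_comp]

/-- The endofunctor of `A / J` induced by an additive endofunctor of `A` preserving `J`. -/
abbrev quotientEndo (J : ObjectProperty A) (F : A ⥤ A) [F.Additive]
    (hF : ∀ Z, J Z → J (F.obj Z)) : QuotientBy J ⥤ QuotientBy J :=
  descend (descends_endo J F hF)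

/-- A monad whose underlying functor is additive and preserves the objects of `J` induces a monad
on the quotient category `A / J`, with the same unit and multiplication. -/
def quotientMonad (J : ObjectProperty A) (T : Monad A) [T.toFunctor.Additive]
    (hT : ∀ Z, J Z → J (T.obj Z)) : Monad (QuotientBy J) where
  toFunctor := quotientEndo J T.toFunctor hT
  η :=
    { app := fun M => (toQuotient J).map (Y := T.obj M.as) (T.η.app M.as)
      naturality := by
        rintro ⟨M⟩ ⟨N⟩ ⟨f⟩
        exact congrArg (toQuotient J).map (T.η.naturality f) }
  μ :=
    { app := fun M => (toQuotient J).map (X := T.obj (T.obj M.as)) (Y := T.obj M.as) (T.μ.app M.as)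
      naturality := by
        rintro ⟨M⟩ ⟨N⟩ ⟨f⟩
        exact congrArg (toQuotient J).map (T.μ.naturality f) }
  assoc := fun M => congrArg (toQuotient J).map (T.assoc M.as)
  left_unit := fun M => congrArg (toQuotient J).map (T.left_unit M.as)
  right_unit := fun M => congrArg (toQuotient J).map (T.right_unit M.as)

/-- The functor from the Eilenberg-Moore category of `T` to that of the monad induced by `T` on
`A / J`, which applies the quotient functor to objects, structure maps and morphisms. -/
def algebraToQuotient (J : ObjectProperty A) (T : Monad A) [T.toFunctor.Additive]
    (hT : ∀ Z, J Z → J (T.obj Z)) : T.Algebra ⥤ (quotientMonad J T hT).Algebra where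
  obj M :=
    { A := (toQuotient J).obj M.A
      a := (toQuotient J).map (X := T.obj M.A) (Y := M.A) M.a
      unit := congrArg (toQuotient J).map M.unit
      assoc := congrArg (toQuotient J).map M.assoc }
  map f :=
    { f := (toQuotient J).map f.f
      h := congrArg (toQuotient J).map f.h }
  map_id M := by ext; exact (toQuotient J).map_id M.A
  map_comp f g := by ext; exact (toQuotient J).map_comp f.f g.f

end Ideals

/-! ### The exact structure and the stable category of a full subcategory -/

section Exact

variable {A : Type u} [Category.{v} A] [Preadditive A]

/-- `f` is a kernel of `g` and `g` is a cokernel of `f`. -/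
def IsKernelCokernelPair {L M N : A} (f : L ⟶ M) (g : M ⟶ N) : Prop :=
  ∃ w : f ≫ g = 0, Nonempty (IsLimit (KernelFork.ofι f w)) ∧
    Nonempty (IsColimit (CokernelCofork.ofπ g w))

/-- The inflations of the exact structure inherited by a full subcategory `P` (the conflations are
the kernel-cokernel pairs of the ambient category all of whose terms lie in `P`). -/
def IsInflation (P : ObjectProperty A) {L M : P.FullSubcategory} (f : L ⟶ M) : Prop :=
  ∃ (N : P.FullSubcategory) (g : M ⟶ N), IsKernelCokernelPair (P.ι.map f) (P.ι.map g)

/-- The injective objects of the full subcategory `P` with respect to its exact structure. -/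
def exactInjective (P : ObjectProperty A) : ObjectProperty P.FullSubcategory := fun I =>
  ∀ ⦃L M : P.FullSubcategory⦄ (i : L ⟶ M), IsInflation P i →
    ∀ φ : L ⟶ I, ∃ ψ : M ⟶ I, i ≫ ψ = φ

/-- The injectively stable category of an abelian category. -/
abbrev Stable (C : Type u) [Category.{v} C] [Abelian C] := QuotientBy (isInjective C)

/-- The functor from an abelian category to its injectively stable category. -/
abbrev toStable (C : Type u) [Category.{v} C] [Abelian C] : C ⥤ Stable C :=
  toQuotient (isInjective C)

/-- An abelian category is hereditary if any cosyzygy is injective, i.e. if `K` is injective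
for any short exact sequence `0 ⟶ N ⟶ I ⟶ K ⟶ 0` with `I` injective. -/
def IsHereditary (C : Type u) [Category.{v} C] [Abelian C] : Prop :=
  ∀ S : ShortComplex C, S.ShortExact → Injective S.X₂ → Injective S.X₃

end Exact

/-- A functor is an epivalence if it is full, dense and reflects isomorphisms. -/
structure IsEpivalence {C : Type u} [Category.{v} C] {D : Type u₁} [Category.{v₁} D]
    (F : C ⥤ D) : Prop where
  full : F.Full
  dense : F.EssSurj
  reflects : F.ReflectsIsomorphisms

/-! ### The free monad of a locally nilpotent endofunctor -/

section FreeMonad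

variable {C : Type u} [Category.{v} C]

/-- The powers of an endofunctor. -/
def iter (X : C ⥤ C) : ℕ → (C ⥤ C)
  | 0 => 𝟭 C
  | n + 1 => iter X n ⋙ X

/-- `X` is locally nilpotent: each object is annihilated by some power of `X`. -/
class LocallyNilpotent (X : C ⥤ C) : Prop where
  exists_isZero : ∀ M : C, ∃ n : ℕ, IsZero ((iter X n).obj M)

/-- The canonical identification of `X ^ i (X ^ j M)` with `X ^ (j + i) M`. -/
def iterAdd (X : C ⥤ C) : (i j : ℕ) → (M : C) →
    ((iter X i).obj ((iter X j).obj M) ≅ (iter X (j + i)).obj M)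
  | 0, _, _ => Iso.refl _
  | i + 1, j, M => X.mapIso (iterAdd X i j M)

theorem iterAdd_naturality (X : C ⥤ C) {M N : C} (f : M ⟶ N) : ∀ i j : ℕ,
    (iter X i).map ((iter X j).map f) ≫ (iterAdd X i j N).hom =
      (iterAdd X i j M).hom ≫ (iter X (j + i)).map f
  | 0, j => (Category.comp_id _).trans (Category.id_comp _).symm
  | i + 1, j => by
      have h := congrArg X.map (iterAdd_naturality X f i j)
      rw [X.map_comp, X.map_comp] at h
      exact h

theorem injective_iter (X : C ⥤ C) [X.PreservesInjectiveObjects] (Z : C) (hZ : Injective Z) :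
    ∀ n, Injective ((iter X n).obj Z)
  | 0 => hZ
  | n + 1 => X.injective_obj_of_injective (injective_iter X Z hZ n)

variable [Preadditive C]

instance iter_additive (X : C ⥤ C) [X.Additive] : ∀ n, (iter X n).Additive
  | 0 => inferInstanceAs (𝟭 C).Additive
  | n + 1 => by
      have := iter_additive X n
      exact inferInstanceAs (iter X n ⋙ X).Additive

theorem exists_forall_isZero (X : C ⥤ C) [X.Additive] [LocallyNilpotent X] (M : C) :
    ∃ n : ℕ, ∀ m, n ≤ m → IsZero ((iter X m).obj M) := by
  obtain ⟨n, hn⟩ := LocallyNilpotent.exists_isZero (X := X) M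
  refine ⟨n, fun m hm => ?_⟩
  induction m, hm using Nat.le_induction with
  | base => exact hn
  | succ m _ ih => exact X.map_isZero ih

theorem exists_isoBiproduct [HasFiniteBiproducts C] (f : ℕ → C) (n : ℕ)
    (hn : ∀ m, n ≤ m → IsZero (f m)) :
    Nonempty (Σ' c : Cofan f, PProd (IsColimit c) (c.pt ≅ ⨁ fun k : Fin n => f k)) := by
  let c : Cofan f := Cofan.mk (⨁ fun k : Fin n => f k) fun m =>
    if h : m < n then biproduct.ι (fun k : Fin n => f k) ⟨m, h⟩ else 0
  refine ⟨⟨c, Cofan.IsColimit.mk c (fun s => biproduct.desc fun k => s.inj k) ?_ ?_, Iso.refl _⟩⟩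
  · intro s j
    by_cases h : j < n
    · simp [c, h]
    · exact (hn j (not_lt.1 h)).eq_of_src _ _
  · intro s m hm
    refine biproduct.hom_ext' _ _ fun k => ?_
    have := hm k
    simpa [c] using this

variable [HasFiniteProducts C] (X : C ⥤ C) [X.Additive] [LocallyNilpotent X]

instance hasCoproduct_iter (M : C) : HasCoproduct fun i : ℕ => (iter X i).obj M := by
  have := HasFiniteBiproducts.of_hasFiniteProducts (C := C)
  obtain ⟨n, hn⟩ := exists_forall_isZero X M
  obtain ⟨⟨c, hc, _⟩⟩ := exists_isoBiproduct _ n hn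
  exact ⟨⟨⟨c, hc⟩⟩⟩

/-- The underlying functor of the free monad: `M` is sent to the coproduct of all `X ^ i M`. -/
def freeFunctor : C ⥤ C where
  obj M := ∐ fun i : ℕ => (iter X i).obj M
  map {_ N} f := Sigma.desc fun i => (iter X i).map f ≫ Sigma.ι (fun j : ℕ => (iter X j).obj N) i

/-- The inclusion of the summand `X ^ i M` into the coproduct of all `X ^ j M`. -/
def inc (M : C) (i : ℕ) : (iter X i).obj M ⟶ (freeFunctor X).obj M :=
  Sigma.ι (fun j : ℕ => (iter X j).obj M) i

/-- The coproduct of all `X ^ j M` with its inclusions. -/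
def isColimitInc (M : C) : IsColimit (Cofan.mk ((freeFunctor X).obj M) (inc X M)) :=
  coproductIsCoproduct fun j : ℕ => (iter X j).obj M

variable {X} in
theorem free_hom_ext {M N : C} {f g : (freeFunctor X).obj M ⟶ N}
    (h : ∀ j, inc X M j ≫ f = inc X M j ≫ g) : f = g :=
  Cofan.IsColimit.hom_ext (isColimitInc X M) _ _ h

/-- The morphism out of the coproduct of all `X ^ j M` with given components. -/
def freeDesc {M N : C} (f : ∀ j, (iter X j).obj M ⟶ N) : (freeFunctor X).obj M ⟶ N :=
  Cofan.IsColimit.desc (isColimitInc X M) f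

@[simp]
theorem inc_freeDesc {M N : C} (f : ∀ j, (iter X j).obj M ⟶ N) (i : ℕ) :
    inc X M i ≫ freeDesc X f = f i :=
  Cofan.IsColimit.fac (isColimitInc X M) f i

@[simp]
theorem inc_map {M N : C} (f : M ⟶ N) (i : ℕ) :
    inc X M i ≫ (freeFunctor X).map f = (iter X i).map f ≫ inc X N i :=
  Sigma.ι_desc _ _

theorem exists_iso_biproduct_iter [HasFiniteBiproducts C] (M : C) :
    ∃ n : ℕ, Nonempty ((freeFunctor X).obj M ≅ ⨁ fun k : Fin n => (iter X k).obj M) := by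
  obtain ⟨n, hn⟩ := exists_forall_isZero X M
  obtain ⟨⟨c, hc, e⟩⟩ := exists_isoBiproduct _ n hn
  exact ⟨n, ⟨(isColimitInc X M).coconePointUniqueUpToIso hc ≪≫ e⟩⟩

/-- An additive functor preserves the (essentially finite) coproduct of all `X ^ j M`. -/
theorem nonempty_isColimit_map {D : Type u₁} [Category.{v₁} D] [Preadditive D] (F : C ⥤ D)
    [F.Additive] (M : C) :
    Nonempty (IsColimit (Cofan.mk (F.obj ((freeFunctor X).obj M))
      fun j : ℕ => F.map (inc X M j))) := by
  obtain ⟨n, hn⟩ := exists_forall_isZero X M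
  let pr (k : ℕ) : (freeFunctor X).obj M ⟶ (iter X k).obj M :=
    freeDesc X fun j => if h : j = k then eqToHom (by rw [h]) else 0
  have hself (k : ℕ) : inc X M k ≫ pr k = 𝟙 _ := by simp [pr]
  have hne (j k : ℕ) (h : j ≠ k) : inc X M j ≫ pr k = 0 := by simp [pr, h]
  have hsum : ∑ k ∈ Finset.range n, pr k ≫ inc X M k = 𝟙 _ := by
    refine free_hom_ext fun j => ?_
    rw [Preadditive.comp_sum, Category.comp_id]
    by_cases hj : j < n
    · rw [Finset.sum_eq_single j]
      · rw [← Category.assoc, hself, Category.id_comp]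
      · intro k _ hk
        rw [← Category.assoc, hne j k hk.symm, zero_comp]
      · intro h
        exact absurd (Finset.mem_range.2 hj) h
    · exact (hn j (not_lt.1 hj)).eq_of_src _ _
  refine ⟨Cofan.IsColimit.mk _
    (fun s => ∑ k ∈ Finset.range n, F.map (pr k) ≫ s.inj k) ?_ ?_⟩
  · intro s j
    change F.map (inc X M j) ≫ _ = _
    rw [Preadditive.comp_sum]
    by_cases hj : j < n
    · rw [Finset.sum_eq_single j]
      · rw [← Category.assoc, ← F.map_comp, hself, F.map_id, Category.id_comp]
      · intro k _ hk
        rw [← Category.assoc, ← F.map_comp, hne j k hk.symm, F.map_zero, zero_comp]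
      · intro h
        exact absurd (Finset.mem_range.2 hj) h
    · exact (F.map_isZero (hn j (not_lt.1 hj))).eq_of_src _ _
  · intro s m hm
    have h1 : m = F.map (∑ k ∈ Finset.range n, pr k ≫ inc X M k) ≫ m := by
      rw [hsum, F.map_id, Category.id_comp]
    rw [h1, F.map_sum, Preadditive.sum_comp]
    refine Finset.sum_congr rfl fun k _ => ?_
    rw [F.map_comp, Category.assoc]
    exact congrArg (F.map (pr k) ≫ ·) (hm k)

theorem map_inc_hom_ext {D : Type u₁} [Category.{v₁} D] [Preadditive D] (F : C ⥤ D)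
    [F.Additive] {M : C} {N : D} {f g : F.obj ((freeFunctor X).obj M) ⟶ N}
    (h : ∀ j, F.map (inc X M j) ≫ f = F.map (inc X M j) ≫ g) : f = g :=
  Cofan.IsColimit.hom_ext (nonempty_isColimit_map X F M).some _ _ h

/-- The multiplication of the free monad: it sends the summand `X ^ i (X ^ j M)` to the summand
`X ^ (j + i) M` through the canonical identification. -/
def freeMul (M : C) : (freeFunctor X).obj ((freeFunctor X).obj M) ⟶ (freeFunctor X).obj M :=
  freeDesc X fun i => Cofan.IsColimit.desc (nonempty_isColimit_map X (iter X i) M).some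
    fun j => (iterAdd X i j M).hom ≫ inc X M (j + i)

theorem inc_freeMul (M : C) (i j : ℕ) :
    (iter X i).map (inc X M j) ≫ inc X ((freeFunctor X).obj M) i ≫ freeMul X M =
      (iterAdd X i j M).hom ≫ inc X M (j + i) := by
  rw [freeMul, inc_freeDesc]
  exact Cofan.IsColimit.fac (nonempty_isColimit_map X (iter X i) M).some _ j

theorem map_inc_one (M : C) (j : ℕ) :
    X.map (inc X M j) ≫ inc X ((freeFunctor X).obj M) 1 ≫ freeMul X M = inc X M (j + 1) := by
  refine (inc_freeMul X M 1 j).trans ?_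
  have : (iterAdd X 1 j M).hom = 𝟙 _ := X.map_id _
  rw [this]
  exact Category.id_comp _

theorem iterAdd_inc_succ (M : C) (i j : ℕ) :
    (iterAdd X (i + 1) j M).hom ≫ inc X M (j + (i + 1)) =
      X.map ((iterAdd X i j M).hom ≫ inc X M (j + i)) ≫
        inc X ((freeFunctor X).obj M) 1 ≫ freeMul X M := by
  rw [X.map_comp, Category.assoc, map_inc_one]
  rfl

theorem iterAdd_inc_zero (M : C) : ∀ i : ℕ,
    (iterAdd X i 0 M).hom ≫ inc X M (0 + i) = inc X M i
  | 0 => Category.id_comp _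
  | i + 1 => by
      rw [iterAdd_inc_succ, iterAdd_inc_zero M i]
      exact map_inc_one X M i

theorem iterAdd_assoc (M : C) (j k : ℕ) : ∀ i : ℕ,
    (iter X i).map (iterAdd X j k M).hom ≫ (iterAdd X i (k + j) M).hom ≫ inc X M (k + j + i) =
      (iterAdd X i j ((iter X k).obj M)).hom ≫ (iterAdd X (j + i) k M).hom ≫
        inc X M (k + (j + i))
  | 0 => by
      refine (congrArg ((iterAdd X j k M).hom ≫ ·) (Category.id_comp _)).trans ?_
      exact (Category.id_comp _).symm
  | i + 1 => by
      have h := congrArg X.map (iterAdd_assoc M j k i)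
      rw [iterAdd_inc_succ]
      refine Eq.trans (b := X.map ((iterAdd X i j ((iter X k).obj M)).hom ≫
        (iterAdd X (j + i) k M).hom ≫ inc X M (k + (j + i))) ≫
          inc X ((freeFunctor X).obj M) 1 ≫ freeMul X M) ?_ ?_
      · rw [← h, X.map_comp ((iter X i).map _), Category.assoc]
        rfl
      · rw [X.map_comp (iterAdd X i j _).hom, Category.assoc]
        exact congrArg (X.map (iterAdd X i j ((iter X k).obj M)).hom ≫ ·)
          (iterAdd_inc_succ X M (j + i) k).symm

/-- The free monad of a locally nilpotent additive endofunctor `X`; its unit is the inclusion of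
the summand `X ^ 0 M = M`. -/
def freeMonad : Monad C where
  toFunctor := freeFunctor X
  η :=
    { app := fun M => inc X M 0
      naturality := fun M N f => (inc_map X f 0).symm }
  μ :=
    { app := freeMul X
      naturality := by
        intro M N f
        refine free_hom_ext fun i => map_inc_hom_ext X (iter X i) fun j => ?_
        change (iter X i).map (inc X M j) ≫ inc X _ i ≫
          (freeFunctor X).map ((freeFunctor X).map f) ≫ freeMul X N =
          (iter X i).map (inc X M j) ≫ inc X _ i ≫ freeMul X M ≫ (freeFunctor X).map f
        have h₁ := congrArg (· ≫ (freeFunctor X).map f) (inc_freeMul X M i j)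
        have h₂ := congrArg (· ≫ inc X N (j + i)) (iterAdd_naturality X f i j)
        have h₃ := congrArg ((iter X i).map · ≫ inc X _ i ≫ freeMul X N) (inc_map X f j)
        have h₄ := congrArg (· ≫ freeMul X N) (inc_map X ((freeFunctor X).map f) i)
        have h₅ := congrArg ((iter X i).map ((iter X j).map f) ≫ ·) (inc_freeMul X N i j)
        have h₆ := congrArg ((iterAdd X i j M).hom ≫ ·) (inc_map X f (j + i))
        simp only [Category.assoc, Functor.map_comp] at h₁ h₂ h₃ h₄ h₅ h₆
        rw [h₁, h₄, h₃, h₅, h₂, h₆] }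
  assoc := by
    intro M
    refine free_hom_ext fun i => map_inc_hom_ext X (iter X i) fun j =>
      map_inc_hom_ext X (iter X j ⋙ iter X i) fun k => ?_
    change (iter X i).map ((iter X j).map (inc X M k)) ≫ (iter X i).map (inc X _ j) ≫
        inc X _ i ≫ (freeFunctor X).map (freeMul X M) ≫ freeMul X M =
      (iter X i).map ((iter X j).map (inc X M k)) ≫ (iter X i).map (inc X _ j) ≫
        inc X _ i ≫ freeMul X _ ≫ freeMul X M
    have h₁ := congrArg (· ≫ freeMul X M) (inc_map X (freeMul X M) i)
    have h₂ := congrArg ((iter X i).map · ≫ inc X _ i ≫ freeMul X M) (inc_freeMul X M j k)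
    have h₃ := congrArg (· ≫ freeMul X M) (inc_freeMul X ((freeFunctor X).obj M) i j)
    have h₄ := congrArg (· ≫ inc X _ (j + i) ≫ freeMul X M)
      (iterAdd_naturality X (inc X M k) i j)
    have h₅ := congrArg ((iter X i).map (iterAdd X j k M).hom ≫ ·) (inc_freeMul X M i (k + j))
    have h₆ := congrArg ((iterAdd X i j ((iter X k).obj M)).hom ≫ ·) (inc_freeMul X M (j + i) k)
    simp only [Category.assoc, Functor.map_comp] at h₁ h₂ h₃ h₄ h₅ h₆
    rw [h₁, h₂, h₅, h₃, h₄, h₆, iterAdd_assoc]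
  left_unit := by
    intro M
    refine free_hom_ext fun j => (inc_freeMul X M 0 j).trans ?_
    exact (Category.id_comp _).trans (Category.comp_id _).symm
  right_unit := by
    intro M
    refine free_hom_ext fun i => ?_
    change inc X M i ≫ (freeFunctor X).map (inc X M 0) ≫ freeMul X M = _
    have h₁ := congrArg (· ≫ freeMul X M) (inc_map X (inc X M 0) i)
    have h₂ := inc_freeMul X M i 0
    simp only [Category.assoc] at h₁
    refine h₁.trans (h₂.trans ?_)
    exact (iterAdd_inc_zero X M i).trans (Category.comp_id _).symm

instance freeMonad_additive : (freeMonad X).toFunctor.Additive where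
  map_add {M N f g} := by
    refine free_hom_ext fun i => ?_
    change inc X M i ≫ (freeFunctor X).map (f + g) =
      inc X M i ≫ ((freeFunctor X).map f + (freeFunctor X).map g)
    rw [Preadditive.comp_add, inc_map, inc_map, inc_map, Functor.map_add, Preadditive.add_comp]

/-- The structure map `X M ⟶ M` of a module over the free monad: the restriction of
`⨁ X ^ i M ⟶ M` to the summand with `i = 1`. -/
def structureMap (M : (freeMonad X).Algebra) : X.obj M.A ⟶ M.A :=
  inc X M.A 1 ≫ M.a

/-- The monomorphism category of `X`, as a full subcategory of the Eilenberg-Moore category of the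
free monad: the structure map `X M ⟶ M` is a monomorphism. -/
def monoProp : ObjectProperty (freeMonad X).Algebra := fun M => Mono (structureMap X M)

/-- The monomorphism category `Mono(X)`. -/
abbrev MonoCat := (monoProp X).FullSubcategory

end FreeMonad

section Canonical

variable {C : Type u} [Category.{v} C] [Abelian C] (X : C ⥤ C) [X.Additive] [LocallyNilpotent X]

theorem injective_free [X.PreservesInjectiveObjects] (Z : C) (hZ : isInjective C Z) :
    isInjective C ((freeMonad X).obj Z) := by
  have := Abelian.hasFiniteBiproducts (C := C)
  obtain ⟨n, ⟨e⟩⟩ := exists_iso_biproduct_iter X Z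
  have := injective_iter X Z hZ
  exact Injective.of_iso e.symm inferInstance

/-- The monad induced by the free monad on the injectively stable category. -/
def stableFreeMonad [X.PreservesInjectiveObjects] : Monad (Stable C) :=
  quotientMonad (isInjective C) (freeMonad X) (injective_free X)

/-- The canonical functor from `Mono(X)` to the Eilenberg-Moore category of the free monad on the
injectively stable category. -/
def monoToStable [X.PreservesInjectiveObjects] : MonoCat X ⥤ (stableFreeMonad X).Algebra :=
  (monoProp X).ι ⋙ algebraToQuotient (isInjective C) (freeMonad X) (injective_free X)

end Canonical

/-! ### Representations of quivers -/

section QuiverRep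

/-- A quiver is acyclic if its only closed paths are the trivial ones. -/
def IsAcyclicQuiver (V : Type u₁) [Quiver.{v₁} V] : Prop :=
  ∀ (i : V) (p : Quiver.Path i i), p = Quiver.Path.nil

/-- Representations of a quiver in a category: functors from the path category. -/
abbrev Rep (V : Type u₁) [Quiver.{v₁} V] (B : Type u) [Category.{v} B] := Paths V ⥤ B

attribute [local instance] Abelian.hasFiniteBiproducts

variable {V : Type u₁} [Quiver.{v₁ + 1} V] [Finite V] [∀ i j : V, Finite (i ⟶ j)]
variable {B : Type u} [Category.{v} B] [Abelian B]

/-- The morphism from the direct sum of the `M_{s(α)}`, over all arrows `α` with target `i`, to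
`M_i`, whose components are the `M_α`. -/
def incoming (M : Rep V B) (i : V) :
    (⨁ fun α : (Σ j : V, (j ⟶ i)) => M.obj ((Paths.of V).obj α.1)) ⟶
      M.obj ((Paths.of V).obj i) :=
  biproduct.desc fun α => M.map ((Paths.of V).map α.2)

variable (V B)

/-- The monomorphism representations of a quiver. -/
def monoRep : ObjectProperty (Rep V B) := fun M => ∀ i : V, Mono (incoming M i)

/-- The canonical functor from the monomorphism category `mono(Q, B)` to the category of
representations of the quiver in the injectively stable category of `B`. -/
def monoRepToStable : (monoRep V B).FullSubcategory ⥤ Rep V (Stable B) :=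
  (monoRep V B).ι ⋙ (Functor.whiskeringRight (Paths V) B (Stable B)).obj (toStable B)

end QuiverRep

end StableMono

end

-- Both monomorphism categories consist of algebras `u : X M ⟶ M` with `u` mono, for an exact,
-- locally nilpotent endofunctor `X` preserving injectives. For the free monad, `u` is the
-- restriction of the action to the summand `X M`. For a quiver, `X` acts on families of objects by
-- summing over incoming arrows, and acyclicity makes it nilpotent. `AlgebraModel` and
-- `IsStableModel` isolate what is common, so that `exists_isEpivalence_descend` settles both cases.
--
-- The engine is `exists_solution`: if `u` is mono and `h : X M ⟶ N` factors through an injective,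
-- then `u ≫ G - X.map G ≫ v = h` has a stably zero solution `G`. Write `h = a ≫ b` through an
-- injective `Z` and extend `a` along `u` to `c : M ⟶ Z`. Then `c ≫ b` is a solution up to an error
-- factoring through the injective `X Z`, and repeating this stops because some `X ^ n Z` vanishes.
--
-- Fullness: a lift to `C` of a stable morphism of algebras respects the structure maps up to a
-- stably zero defect, which the equation removes. Density: adding to `M` the free algebra on an
-- injective hull of `X M` makes the structure map mono without changing the stable object. Exact
-- injectives are the algebras with injective underlying object: extend in `C`, then correct the
-- extension by solving the equation on the cokernel. Isomorphisms: if `f : M ⟶ N` is stably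
-- invertible and `M` embeds strictly into an injective algebra `E`, then `M ⟶ N ⊞ E` splits as a
-- morphism of algebras, with injective complement.
--
-- Faithfulness: a stably zero morphism of algebras `M ⟶ N` extends to `E` in `C`, and the
-- obstruction to an extension of algebras is a morphism `X (E / M) ⟶ N`. It is harmless if `X`
-- sends cosyzygies to injectives. Conversely, `injective_obj_of_forall_extension` picks one
-- equation whose solvability makes `X K` a retract of an injective, for `K` a cosyzygy. By
-- dimension shifting the condition says that each `X M` has injective dimension at most one; for a
-- quiver with an arrow it says that `B` is hereditary.

universe v₂ u₂

noncomputable section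

namespace StableMono

/-! ### Morphisms factoring through injective objects -/

section StablyZero

variable {C : Type u} [Category.{v} C]

/-- A morphism is stably zero if it factors through an injective object. -/
def IsStablyZero {M N : C} (f : M ⟶ N) : Prop :=
  ∃ (Z : C) (_ : Injective Z) (a : M ⟶ Z) (b : Z ⟶ N), f = a ≫ b

namespace IsStablyZero

theorem of_source {M N : C} [hM : Injective M] (f : M ⟶ N) : IsStablyZero f :=
  ⟨M, hM, 𝟙 M, f, (Category.id_comp f).symm⟩

theorem of_target {M N : C} [hN : Injective N] (f : M ⟶ N) : IsStablyZero f :=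
  ⟨N, hN, f, 𝟙 N, (Category.comp_id f).symm⟩

theorem comp_left {L M N : C} (g : L ⟶ M) {f : M ⟶ N} (hf : IsStablyZero f) :
    IsStablyZero (g ≫ f) := by
  obtain ⟨Z, hZ, a, b, rfl⟩ := hf
  exact ⟨Z, hZ, g ≫ a, b, (Category.assoc _ _ _).symm⟩

theorem comp_right {L M N : C} {f : L ⟶ M} (hf : IsStablyZero f) (g : M ⟶ N) :
    IsStablyZero (f ≫ g) := by
  obtain ⟨Z, hZ, a, b, rfl⟩ := hf
  exact ⟨Z, hZ, a, b ≫ g, Category.assoc _ _ _⟩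

theorem exists_extension {L M N : C} {f : L ⟶ N} (hf : IsStablyZero f) (i : L ⟶ M) [Mono i] :
    ∃ g : M ⟶ N, IsStablyZero g ∧ i ≫ g = f := by
  obtain ⟨Z, hZ, a, b, rfl⟩ := hf
  exact ⟨Injective.factorThru a i ≫ b, ⟨Z, hZ, _, _, rfl⟩, by simp⟩

theorem map {D : Type u₁} [Category.{v₁} D] (F : C ⥤ D)
    [F.PreservesInjectiveObjects] {M N : C} {f : M ⟶ N} (hf : IsStablyZero f) :
    IsStablyZero (F.map f) := by
  obtain ⟨Z, hZ, a, b, rfl⟩ := hf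
  exact ⟨F.obj Z, F.injective_obj_of_injective hZ, F.map a, F.map b, F.map_comp a b⟩

end IsStablyZero

theorem injective_of_isStablyZero_id {M : C} (h : IsStablyZero (𝟙 M)) : Injective M := by
  obtain ⟨Z, hZ, a, b, h⟩ := h
  exact Retract.injective ⟨a, b, h.symm⟩

variable [Abelian C]

namespace IsStablyZero

theorem zero (M N : C) : IsStablyZero (0 : M ⟶ N) := by
  open scoped ZeroObject in
  exact ⟨0, inferInstance, 0, 0, comp_zero.symm⟩

theorem add {M N : C} {f g : M ⟶ N} (hf : IsStablyZero f) (hg : IsStablyZero g) :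
    IsStablyZero (f + g) := by
  obtain ⟨Z, hZ, a, b, rfl⟩ := hf
  obtain ⟨W, hW, c, d, rfl⟩ := hg
  exact ⟨Z ⊞ W, inferInstance, biprod.lift a c, biprod.desc b d, by simp⟩

theorem neg {M N : C} {f : M ⟶ N} (hf : IsStablyZero f) : IsStablyZero (-f) := by
  obtain ⟨Z, hZ, a, b, rfl⟩ := hf
  exact ⟨Z, hZ, -a, b, by simp⟩

theorem sub {M N : C} {f g : M ⟶ N} (hf : IsStablyZero f) (hg : IsStablyZero g) :
    IsStablyZero (f - g) := by
  rw [sub_eq_add_neg]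
  exact hf.add hg.neg

end IsStablyZero

theorem factorRel_isInjective_iff {M N : C} (f g : M ⟶ N) :
    factorRel (isInjective C) f g ↔ IsStablyZero (f - g) :=
  Iff.rfl

/-- The quotient category imposes the congruence generated by the relation. As the relation is
already a congruence, since sums of injectives are injective, equality in the quotient is tested by
a single factorization. -/
instance factorRel_isInjective_congruence : Congruence (factorRel (isInjective C)) where
  equivalence :=
    { refl := fun f => by
        rw [factorRel_isInjective_iff, sub_self]
        exact .zero _ _
      symm := fun {f g} h => by
        rw [factorRel_isInjective_iff] at h ⊢
        rw [← neg_sub]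
        exact h.neg
      trans := fun {f g h} h₁ h₂ => by
        rw [factorRel_isInjective_iff] at h₁ h₂ ⊢
        rw [← sub_add_sub_cancel f g h]
        exact h₁.add h₂ }
  comp_left f _ _ h := by
    rw [factorRel_isInjective_iff] at h ⊢
    rw [← Preadditive.comp_sub]
    exact h.comp_left f
  comp_right g h := by
    rw [factorRel_isInjective_iff] at h ⊢
    rw [← Preadditive.sub_comp]
    exact h.comp_right g

theorem toStable_map_eq_iff {M N : C} (f g : M ⟶ N) :
    (toStable C).map f = (toStable C).map g ↔ IsStablyZero (f - g) :=
  Quotient.functor_map_eq_iff _ f g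

end StablyZero

/-! ### Algebras over an endofunctor, given by their structure maps -/

section EndoAlgebra

/-- `iter` adds the new copy of `X` on the outside, while the induction solving the equation
replaces `Z` by `X Z` and needs it on the inside. -/
theorem isZero_iter_obj {C : Type u} [Category.{v} C] (X : C ⥤ C) {Z : C} {n : ℕ} (h : IsZero ((iter X (n + 1)).obj Z)) :
    IsZero ((iter X n).obj (X.obj Z)) := by
  rw [Nat.add_comm] at h
  exact h.of_iso (iterAdd X n 1 Z)

variable {C : Type u} [Category.{v} C] [Abelian C] (X : C ⥤ C) [X.Additive]

/-! ### The equation `u ≫ G - X.map G ≫ v = h` -/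

section Solve

variable [X.PreservesInjectiveObjects]

/-- Extending `a` along `u` to `c` solves the equation by `c ≫ b` up to the term `X.map c ≫ X.map b
≫ v`. This factors through `X Z`, which is injective and one step closer to being killed. -/
theorem exists_solution_of_isZero_iter {M N : C} (u : X.obj M ⟶ M) [Mono u] (v : X.obj N ⟶ N)
    (n : ℕ) : ∀ (Z : C) [Injective Z], IsZero ((iter X n).obj Z) →
      ∀ (a : X.obj M ⟶ Z) (b : Z ⟶ N), ∃ G : M ⟶ N, IsStablyZero G ∧
        u ≫ G - X.map G ≫ v = a ≫ b := by
  induction n with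
  | zero =>
      intro Z _ h a b
      have ha : a = 0 := IsZero.eq_of_tgt h _ _
      exact ⟨0, .zero _ _, by simp [ha]⟩
  | succ n ih =>
      intro Z hZ h a b
      let c := Injective.factorThru a u
      have hc : u ≫ c = a := Injective.comp_factorThru a u
      have := X.injective_obj_of_injective hZ
      obtain ⟨G, hG, e⟩ := ih (X.obj Z) (isZero_iter_obj X h) (X.map c) (X.map b ≫ v)
      refine ⟨c ≫ b + G, IsStablyZero.add ⟨Z, hZ, c, b, rfl⟩ hG, ?_⟩
      rw [X.map_add, Preadditive.comp_add, Preadditive.add_comp, X.map_comp, Category.assoc, ← e,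
        reassoc_of% hc]
      abel

variable [LocallyNilpotent X]

/-- A stably zero perturbation of the algebra equation can be solved: given `h : X M ⟶ N`
factoring through an injective object, there is `G : M ⟶ N` measuring `h`. -/
theorem exists_solution {M N : C} (u : X.obj M ⟶ M) [Mono u] (v : X.obj N ⟶ N)
    (h : X.obj M ⟶ N) (hh : IsStablyZero h) :
    ∃ G : M ⟶ N, IsStablyZero G ∧ u ≫ G - X.map G ≫ v = h := by
  obtain ⟨Z, hZ, a, b, rfl⟩ := hh
  obtain ⟨n, hn⟩ := LocallyNilpotent.exists_isZero (X := X) Z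
  exact exists_solution_of_isZero_iter X u v n Z hn a b

/-- A morphism which respects the structure maps up to a stably zero morphism can be corrected by
a stably zero morphism. -/
theorem exists_correction {M N : C} (u : X.obj M ⟶ M) [Mono u] (v : X.obj N ⟶ N) (f : M ⟶ N)
    (hf : IsStablyZero (X.map f ≫ v - u ≫ f)) :
    ∃ g : M ⟶ N, X.map g ≫ v = u ≫ g ∧ IsStablyZero (g - f) := by
  obtain ⟨G, hG, e⟩ := exists_solution X u v _ hf
  refine ⟨f + G, ?_, by simpa using hG⟩
  rw [X.map_add, Preadditive.comp_add, Preadditive.add_comp]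
  rw [sub_eq_sub_iff_add_eq_add] at e
  rw [add_comm (u ≫ f), e]

variable [PreservesFiniteLimits X] [PreservesFiniteColimits X]

/-- A morphism out of the middle term of a short exact sequence of algebras, whose restriction to
the first term is a morphism of algebras, can be corrected to a morphism of algebras. -/
theorem exists_algebra_extension {S : ShortComplex C} (hS : S.ShortExact) (u₁ : X.obj S.X₁ ⟶ S.X₁)
    (u₂ : X.obj S.X₂ ⟶ S.X₂) (u₃ : X.obj S.X₃ ⟶ S.X₃) [Mono u₃]
    (hf : X.map S.f ≫ u₂ = u₁ ≫ S.f) (hg : X.map S.g ≫ u₃ = u₂ ≫ S.g)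
    {N : C} (v : X.obj N ⟶ N) (hN : ∀ h : X.obj S.X₃ ⟶ N, IsStablyZero h)
    (ψ : S.X₂ ⟶ N) (hψ : X.map (S.f ≫ ψ) ≫ v = u₁ ≫ S.f ≫ ψ) :
    ∃ φ : S.X₂ ⟶ N, X.map φ ≫ v = u₂ ≫ φ ∧ S.f ≫ φ = S.f ≫ ψ := by
  have hXS : (S.map X).ShortExact := hS.map_of_exact X
  have := hXS.epi_g
  have hz : (S.map X).f ≫ (u₂ ≫ ψ - X.map ψ ≫ v) = 0 := by
    change X.map S.f ≫ _ = 0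
    -- The defect of `ψ` vanishes on `X S.X₁`, hence comes from some `h` on `X S.X₃`. Solving for
    -- `h` on the quotient changes `ψ` only by a morphism vanishing on `S.X₁`.
    rw [Preadditive.comp_sub, reassoc_of% hf, ← hψ, X.map_comp, Category.assoc, sub_self]
  let h : X.obj S.X₃ ⟶ N := hXS.exact.desc _ hz
  have hh : X.map S.g ≫ h = u₂ ≫ ψ - X.map ψ ≫ v := hXS.exact.g_desc _ hz
  obtain ⟨G, -, e⟩ := exists_solution X u₃ v h (hN h)
  refine ⟨ψ - S.g ≫ G, ?_, by simp⟩
  have e' := congrArg (X.map S.g ≫ ·) e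
  simp only [Preadditive.comp_sub, hh, reassoc_of% hg] at e'
  rw [X.map_sub, X.map_comp, Preadditive.comp_sub, Preadditive.sub_comp, Category.assoc]
  rw [sub_eq_sub_iff_add_eq_add] at e' ⊢
  rw [add_comm, ← e', add_comm]

end Solve

/-! ### Free algebras -/

section Free

variable [LocallyNilpotent X]

/-- The structure map of the free algebra on `J`. -/
def freeStr (J : C) : X.obj ((freeFunctor X).obj J) ⟶ (freeFunctor X).obj J :=
  inc X ((freeFunctor X).obj J) 1 ≫ freeMul X J

/-- The inclusion of the generators into the free algebra on `J`. -/
def freeUnit (J : C) : J ⟶ (freeFunctor X).obj J :=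
  inc X J 0

/-- The components of the algebra morphism out of a free algebra. -/
def powMap {M N : C} (v : X.obj N ⟶ N) (g : M ⟶ N) : (j : ℕ) → ((iter X j).obj M ⟶ N)
  | 0 => g
  | j + 1 => X.map (powMap v g j) ≫ v

/-- The algebra morphism out of a free algebra. -/
def freeLift {M N : C} (v : X.obj N ⟶ N) (g : M ⟶ N) : (freeFunctor X).obj M ⟶ N :=
  freeDesc X (powMap X v g)

theorem freeUnit_freeLift {M N : C} (v : X.obj N ⟶ N) (g : M ⟶ N) :
    freeUnit X M ≫ freeLift X v g = g :=
  inc_freeDesc X _ 0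

theorem map_inc_freeStr {M N : C} (j : ℕ) (f : ∀ j, (iter X j).obj M ⟶ N) :
    X.map (inc X M j) ≫ freeStr X M ≫ freeDesc X f = f (j + 1) := by
  have e : X.map (inc X M j) ≫ freeStr X M = inc X M (j + 1) := map_inc_one X M j
  rw [← Category.assoc]
  exact (congrArg (· ≫ freeDesc X f) e).trans (inc_freeDesc X f (j + 1))

theorem freeLift_comm {M N : C} (v : X.obj N ⟶ N) (g : M ⟶ N) :
    X.map (freeLift X v g) ≫ v = freeStr X M ≫ freeLift X v g := by
  refine map_inc_hom_ext X X fun j => ?_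
  rw [freeLift, map_inc_freeStr, ← X.map_comp_assoc, inc_freeDesc]
  rfl

/-- The inclusion of `X ^ (j + 1) M` is `X` of the inclusion of `X ^ j M` followed by the structure
map, so agreement propagates from the generators by induction. -/
theorem free_algebra_hom_ext {M N : C} (v : X.obj N ⟶ N) {f g : (freeFunctor X).obj M ⟶ N}
    (hf : X.map f ≫ v = freeStr X M ≫ f) (hg : X.map g ≫ v = freeStr X M ≫ g)
    (h : freeUnit X M ≫ f = freeUnit X M ≫ g) : f = g := by
  refine free_hom_ext fun j => ?_
  induction j with
  | zero => exact h
  | succ j ih =>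
      have e : X.map (inc X M j) ≫ freeStr X M = inc X M (j + 1) := map_inc_one X M j
      refine ((congrArg (· ≫ f) e).symm.trans ?_).trans (congrArg (· ≫ g) e)
      rw [Category.assoc, Category.assoc, ← hf, ← hg, ← X.map_comp_assoc, ← X.map_comp_assoc, ih]

/-- The projection of a free algebra onto its generators. -/
def freeTop (J : C) : (freeFunctor X).obj J ⟶ J :=
  freeLift X 0 (𝟙 J)

theorem freeUnit_freeTop (J : C) : freeUnit X J ≫ freeTop X J = 𝟙 J :=
  freeUnit_freeLift X 0 (𝟙 J)

/-- `freeTop` is the morphism of algebras to `J` with zero structure map. -/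
theorem freeStr_freeTop (J : C) : freeStr X J ≫ freeTop X J = 0 := by
  rw [freeTop, ← freeLift_comm, comp_zero]

/-- The structure map shifts the summands up by one; shifting down and killing the generators is a
left inverse. -/
instance mono_freeStr (J : C) : Mono (freeStr X J) := by
  let r : (freeFunctor X).obj J ⟶ X.obj ((freeFunctor X).obj J) := freeDesc X fun j =>
    match j with
    | 0 => 0
    | j + 1 => X.map (inc X J j)
  have : freeStr X J ≫ r = 𝟙 _ := by
    refine map_inc_hom_ext X X fun j => ?_
    rw [map_inc_freeStr, Category.comp_id]
  exact mono_of_mono_fac this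

end Free

/-! ### Embeddings into injective algebras -/

section Embedding

section Exact

variable [PreservesFiniteLimits X] [PreservesFiniteColimits X]

theorem exists_cokernel_structure {S : ShortComplex C} (hS : S.ShortExact)
    (u₁ : X.obj S.X₁ ⟶ S.X₁) (u₂ : X.obj S.X₂ ⟶ S.X₂) (hf : X.map S.f ≫ u₂ = u₁ ≫ S.f) :
    ∃ u₃ : X.obj S.X₃ ⟶ S.X₃, X.map S.g ≫ u₃ = u₂ ≫ S.g := by
  have hXS : (S.map X).ShortExact := hS.map_of_exact X
  have := hXS.epi_g
  have hz : X.map S.f ≫ u₂ ≫ S.g = 0 := by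
    rw [reassoc_of% hf, S.zero, comp_zero]
  exact ⟨hXS.exact.desc (u₂ ≫ S.g) hz, hXS.exact.g_desc (u₂ ≫ S.g) hz⟩

/-- The structure map of the cokernel of an algebra monomorphism which meets the image of the
structure map in the expected way is a monomorphism. -/
theorem mono_of_strict {S : ShortComplex C} (hS : S.ShortExact) (u₁ : X.obj S.X₁ ⟶ S.X₁)
    (u₂ : X.obj S.X₂ ⟶ S.X₂) (u₃ : X.obj S.X₃ ⟶ S.X₃) [Mono u₂]
    (hf : X.map S.f ≫ u₂ = u₁ ≫ S.f) (hg : X.map S.g ≫ u₃ = u₂ ≫ S.g)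
    (hs : ∀ ⦃A : C⦄ (m : A ⟶ S.X₁) (y : A ⟶ X.obj S.X₂), m ≫ S.f = y ≫ u₂ →
      ∃ n, m = n ≫ u₁) : Mono u₃ := by
  have hXS : (S.map X).ShortExact := hS.map_of_exact X
  have : Epi (X.map S.g) := hXS.epi_g
  refine Preadditive.mono_of_cancel_zero _ fun {A} x hx => ?_
  obtain ⟨A₁, π₁, _, y, hy⟩ := surjective_up_to_refinements_of_epi (X.map S.g) x
  obtain ⟨A₂, π₂, _, m, hm⟩ := hS.exact.exact_up_to_refinements (y ≫ u₂) (by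
    rw [Category.assoc, ← hg, ← reassoc_of% hy, hx, comp_zero])
  -- An element of `X S.X₂` whose image under `u₂` lies in `S.X₁` comes from `X S.X₁` by strictness,
  -- so it dies in `X S.X₃`.
  obtain ⟨n, rfl⟩ := hs m (π₂ ≫ y) (by rw [← hm, Category.assoc])
  have h₁ : π₂ ≫ y = n ≫ X.map S.f := by
    rw [← cancel_mono u₂, Category.assoc, hm, Category.assoc, Category.assoc, hf]
  have h₂ : π₂ ≫ π₁ ≫ x = 0 := by
    rw [hy, reassoc_of% h₁, ← X.map_comp, S.zero, X.map_zero, comp_zero]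
  rwa [← cancel_epi π₁, ← cancel_epi π₂, comp_zero, comp_zero]

variable [LocallyNilpotent X]

/-- Strictness alone gives injectivity. The kernel lies in the image of `u`, and as `v` is mono its
preimage in `X M` lies in the kernel of `X.map i`, which is `X` of the kernel of `i`. Iterating, the
kernel inclusion factors through every `X ^ n M`, hence vanishes. -/
theorem mono_of_strict_comp {M N : C} (u : X.obj M ⟶ M) (v : X.obj N ⟶ N) [Mono v] (i : M ⟶ N)
    (hi : X.map i ≫ v = u ≫ i)
    (hs : ∀ ⦃A : C⦄ (m : A ⟶ M) (y : A ⟶ X.obj N), m ≫ i = y ≫ v → ∃ n, m = n ≫ u) : Mono i := by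
  have key (n : ℕ) : ∃ l : kernel i ⟶ (iter X n).obj M,
      kernel.ι i = l ≫ powMap X u (𝟙 M) n := by
    induction n with
    | zero => exact ⟨kernel.ι i, (Category.comp_id _).symm⟩
    | succ n ih =>
        obtain ⟨l, hl⟩ := ih
        -- Strictness with `y = 0`, since the kernel maps to zero.
        obtain ⟨m, hm⟩ := hs (kernel.ι i) 0 (by simp)
        have hm' : m ≫ X.map i = 0 := by
          rw [← cancel_mono v, Category.assoc, hi, ← reassoc_of% hm, kernel.condition, zero_comp]
        let S := ShortComplex.mk (kernel.ι i) i (kernel.condition i)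
        have hS : S.Exact := S.exact_of_f_is_kernel (kernelIsKernel i)
        have hXS : (S.map X).Exact := hS.map X
        have : Mono (S.map X).f := inferInstanceAs (Mono (X.map (kernel.ι i)))
        let t : kernel i ⟶ X.obj (kernel i) := hXS.lift m hm'
        have ht : t ≫ X.map (kernel.ι i) = m := hXS.lift_f m hm'
        refine ⟨t ≫ X.map l, ?_⟩
        change _ = (t ≫ X.map l) ≫ X.map (powMap X u (𝟙 M) n) ≫ u
        rw [Category.assoc, ← X.map_comp_assoc, ← hl, reassoc_of% ht, hm]
  obtain ⟨n, hn⟩ := LocallyNilpotent.exists_isZero (X := X) M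
  obtain ⟨l, hl⟩ := key n
  refine Preadditive.mono_of_kernel_zero ?_
  rw [hl, hn.eq_of_tgt l 0, zero_comp]

end Exact

variable [LocallyNilpotent X] [X.PreservesInjectiveObjects] [EnoughInjectives C]

/-- An algebra with monic structure map embeds strictly into a free algebra on an injective
object. -/
theorem exists_strict_embedding {M : C} (u : X.obj M ⟶ M) [Mono u] :
    ∃ (J : C) (_ : Injective J) (i : M ⟶ (freeFunctor X).obj J),
      X.map i ≫ freeStr X J = u ≫ i ∧ ∀ ⦃A : C⦄ (m : A ⟶ M) (y : A ⟶ X.obj _),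
        m ≫ i = y ≫ freeStr X J → ∃ n, m = n ≫ u := by
  let J := Injective.under (cokernel u)
  let a : M ⟶ J := cokernel.π u ≫ Injective.ι (cokernel u)
  have ha : u ≫ a = 0 := by simp [a]
  let h : X.obj M ⟶ X.obj ((freeFunctor X).obj J) := X.map (a ≫ freeUnit X J)
  have hh : IsStablyZero h :=
    IsStablyZero.map X ⟨J, inferInstance, a, freeUnit X J, rfl⟩
  -- The map `i = a ≫ freeUnit + G ≫ freeStr` is to be a morphism of algebras with `i ≫ freeTop =
  -- a`. As `u ≫ a = 0`, it suffices to have the given equation for `G`, with target the algebra `X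
  -- T(J)` with structure map `X.map freeStr`.
  obtain ⟨G, -, e⟩ := exists_solution X u (X.map (freeStr X J)) h hh
  let i : M ⟶ (freeFunctor X).obj J := a ≫ freeUnit X J + G ≫ freeStr X J
  have hi : X.map i ≫ freeStr X J = u ≫ i := by
    have e' := congrArg (· ≫ freeStr X J) e
    simp only [Preadditive.sub_comp, Category.assoc] at e'
    rw [sub_eq_iff_eq_add] at e'
    have ha' : u ≫ a ≫ freeUnit X J = 0 := by rw [reassoc_of% ha, zero_comp]
    simp only [i, X.map_add, Preadditive.add_comp, Preadditive.comp_add, ha', zero_add, e',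
      X.map_comp, Category.assoc, h]
  have hit : i ≫ freeTop X J = a := by
    simp only [i, Preadditive.add_comp, Category.assoc, freeStr_freeTop, freeUnit_freeTop,
      comp_zero, add_zero, Category.comp_id]
  refine ⟨J, inferInstance, i, hi, fun A m y hm => ?_⟩
  -- Projecting to the generators kills the image of `freeStr` and turns `i` into `a`, which detects
  -- the cokernel of `u`.
  have hma : m ≫ cokernel.π u = 0 := by
    rw [← cancel_mono (Injective.ι (cokernel u)), zero_comp, Category.assoc]
    change m ≫ a = 0
    rw [← hit, reassoc_of% hm, freeStr_freeTop, comp_zero]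
  exact ⟨Abelian.monoLift u m hma, (Abelian.monoLift_comp u m hma).symm⟩

end Embedding

end EndoAlgebra

/-! ### Making the structure map a monomorphism -/

section Replacement

variable {C : Type u} [Category.{v} C] [Abelian C] (X : C ⥤ C) [X.Additive]

theorem eq_zero_of_comp_map_biprod {A M N : C} (x : A ⟶ X.obj (M ⊞ N))
    (h₁ : x ≫ X.map biprod.fst = 0) (h₂ : x ≫ X.map biprod.snd = 0) : x = 0 := by
  rw [← Category.comp_id x, ← X.map_id, ← biprod.total, X.map_add, X.map_comp, X.map_comp,
    Preadditive.comp_add, reassoc_of% h₁, reassoc_of% h₂]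
  simp

variable [LocallyNilpotent X]

/-- The structure map on `M ⊞ T(J)`, for `T(J)` the free algebra on `J`, given by a structure map
on `M` and a morphism from `X M` to the generators of `T(J)`. -/
def replacementStr {M J : C} (u : X.obj M ⟶ M) (j : X.obj M ⟶ J) :
    X.obj (M ⊞ (freeFunctor X).obj J) ⟶ M ⊞ (freeFunctor X).obj J :=
  X.map biprod.fst ≫ biprod.lift u (j ≫ freeUnit X J) +
    X.map biprod.snd ≫ freeStr X J ≫ biprod.inr

theorem map_inl_replacementStr {M J : C} (u : X.obj M ⟶ M) (j : X.obj M ⟶ J) :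
    X.map biprod.inl ≫ replacementStr X u j = biprod.lift u (j ≫ freeUnit X J) := by
  rw [replacementStr, Preadditive.comp_add, ← X.map_comp_assoc, ← X.map_comp_assoc]
  simp

theorem map_inr_replacementStr {M J : C} (u : X.obj M ⟶ M) (j : X.obj M ⟶ J) :
    X.map biprod.inr ≫ replacementStr X u j = freeStr X J ≫ biprod.inr := by
  rw [replacementStr, Preadditive.comp_add, ← X.map_comp_assoc, ← X.map_comp_assoc]
  simp

/-- In `T(J)` the generators meet the image of `freeStr` trivially. Hence `freeTop` isolates the
component in `X M`, detected by `j`, and then `freeStr` detects the rest. -/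
instance mono_replacementStr {M J : C} (u : X.obj M ⟶ M) (j : X.obj M ⟶ J) [Mono j] :
    Mono (replacementStr X u j) := by
  refine Preadditive.mono_of_cancel_zero _ fun {A} x hx => ?_
  have h := congrArg (· ≫ biprod.snd) hx
  simp only [replacementStr, Preadditive.comp_add, Preadditive.add_comp, Category.assoc,
    biprod.lift_snd, biprod.inr_snd, Category.comp_id, zero_comp] at h
  have h₁ : x ≫ X.map biprod.fst = 0 := by
    have h' := congrArg (· ≫ freeTop X J) h
    simp only [Preadditive.add_comp, Category.assoc, freeUnit_freeTop, freeStr_freeTop, comp_zero,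
      add_zero, zero_comp, Category.comp_id] at h'
    rw [← cancel_mono j, Category.assoc, h', zero_comp]
  have h₂ : x ≫ X.map biprod.snd = 0 := by
    rw [reassoc_of% h₁, zero_comp, zero_add] at h
    rw [← cancel_mono (freeStr X J), Category.assoc, h, zero_comp]
  exact eq_zero_of_comp_map_biprod X x h₁ h₂

variable [X.PreservesInjectiveObjects]

instance injective_freeFunctor_obj (J : C) [hJ : Injective J] :
    Injective ((freeFunctor X).obj J) :=
  injective_free X J hJ

/-- Every algebra is stably isomorphic to one whose structure map is a monomorphism. -/
theorem exists_mono_replacement [EnoughInjectives C] {M : C} (u : X.obj M ⟶ M) :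
    ∃ (N : C) (v : X.obj N ⟶ N) (_ : Mono v) (w : M ⟶ N) (w' : N ⟶ M), w ≫ w' = 𝟙 M ∧
      IsStablyZero (w' ≫ w - 𝟙 N) ∧ IsStablyZero (X.map w ≫ v - u ≫ w) := by
  let j := Injective.ι (X.obj M)
  refine ⟨_, replacementStr X u j, inferInstance, biprod.inl, biprod.fst, biprod.inl_fst, ?_, ?_⟩
  · rw [← biprod.total, sub_add_cancel_left]
    exact ((IsStablyZero.of_source biprod.inr).comp_left biprod.snd).neg
  -- The inclusion of `M` fails to be a morphism of algebras exactly by the added component, which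
  -- passes through the injective `J`.
  · refine ⟨Injective.under (X.obj M), inferInstance, j, freeUnit X _ ≫ biprod.inr, ?_⟩
    rw [map_inl_replacementStr]
    ext <;> simp

end Replacement

/-! ### Splitting stable isomorphisms, and the obstruction to faithfulness -/

section Retraction

variable {C : Type u} [Category.{v} C] [Abelian C] (X : C ⥤ C) [X.Additive] [LocallyNilpotent X]
  [PreservesFiniteLimits X] [PreservesFiniteColimits X] [X.PreservesInjectiveObjects]

/-- A morphism of algebras with monic structure maps which is a stable isomorphism has an inverse
up to morphisms factoring through algebras with injective underlying object. -/
theorem exists_inverse_modulo_injective {M N E : C} (u : X.obj M ⟶ M) (v : X.obj N ⟶ N)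
    (w : X.obj E ⟶ E) [Mono v] [Mono w] [Injective E] (f : M ⟶ N)
    (hf : X.map f ≫ v = u ≫ f) (i : M ⟶ E) (hi : X.map i ≫ w = u ≫ i)
    (hs : ∀ ⦃A : C⦄ (m : A ⟶ M) (y : A ⟶ X.obj E), m ≫ i = y ≫ w → ∃ n, m = n ≫ u)
    (g : N ⟶ M) (hfg : IsStablyZero (f ≫ g - 𝟙 M)) (hgf : IsStablyZero (g ≫ f - 𝟙 N)) :
    ∃ (K : C) (_ : Injective K) (k : X.obj K ⟶ K) (_ : Mono k) (r : N ⟶ M) (t : E ⟶ M)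
      (q : N ⟶ K) (s : K ⟶ N), X.map r ≫ u = v ≫ r ∧ X.map t ≫ u = w ≫ t ∧
        X.map q ≫ k = v ≫ q ∧ X.map s ≫ v = k ≫ s ∧
        f ≫ r + i ≫ t = 𝟙 M ∧ r ≫ f + q ≫ s = 𝟙 N := by
  have := mono_of_strict_comp X u w i hi hs
  let c : X.obj (N ⊞ E) ⟶ N ⊞ E :=
    biprod.lift (X.map biprod.fst ≫ v) (X.map biprod.snd ≫ w)
  have hc₁ : c ≫ biprod.fst = X.map biprod.fst ≫ v := biprod.lift_fst _ _
  have hc₂ : c ≫ biprod.snd = X.map biprod.snd ≫ w := biprod.lift_snd _ _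
  have : Mono c := by
    refine Preadditive.mono_of_cancel_zero _ fun {A} x hx =>
      eq_zero_of_comp_map_biprod X x ?_ ?_
    · rw [← cancel_mono v, Category.assoc, ← hc₁, reassoc_of% hx, zero_comp, zero_comp]
    · rw [← cancel_mono w, Category.assoc, ← hc₂, reassoc_of% hx, zero_comp, zero_comp]
  have hinl : X.map biprod.inl ≫ c = v ≫ biprod.inl := by
    ext
    · rw [Category.assoc, hc₁, ← X.map_comp_assoc]
      simp
    · rw [Category.assoc, hc₂, ← X.map_comp_assoc]
      simp
  have hinr : X.map biprod.inr ≫ c = w ≫ biprod.inr := by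
    ext
    · rw [Category.assoc, hc₁, ← X.map_comp_assoc]
      simp
    · rw [Category.assoc, hc₂, ← X.map_comp_assoc]
      simp
  let f' : M ⟶ N ⊞ E := biprod.lift f i
  have hf'₁ : f' ≫ biprod.fst = f := biprod.lift_fst _ _
  have hf'₂ : f' ≫ biprod.snd = i := biprod.lift_snd _ _
  have hf' : X.map f' ≫ c = u ≫ f' := by
    ext
    · rw [Category.assoc, hc₁, ← X.map_comp_assoc, Category.assoc, hf'₁, hf]
    · rw [Category.assoc, hc₂, ← X.map_comp_assoc, Category.assoc, hf'₂, hi]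
  have : Mono f' := mono_of_mono_fac hf'₂
  let S := ShortComplex.mk f' (cokernel.π f') (cokernel.condition f')
  have : Mono S.f := this
  have : Epi S.g := inferInstanceAs (Epi (cokernel.π f'))
  have hS : S.ShortExact := { exact := S.exact_of_g_is_cokernel (cokernelIsCokernel f') }
  obtain ⟨k, hk⟩ := exists_cokernel_structure X hS u c hf'
  -- The map `f'` inherits strictness from its component `i`.
  have : Mono k := mono_of_strict X hS u c k hf' hk fun A m y hm => by
    refine hs m (y ≫ X.map biprod.snd) ?_
    have h := congrArg (· ≫ biprod.snd) hm
    simp only [Category.assoc, hc₂] at h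
    rw [Category.assoc, ← h]
    exact congrArg (m ≫ ·) hf'₂.symm
  -- The composite `f' ≫ biprod.fst ≫ g = f ≫ g` differs from the identity by a stably zero
  -- morphism; subtracting an extension of it along `f'` yields a retraction in `C`.
  obtain ⟨a, ha, ha'⟩ := hfg.exists_extension f'
  let ρ : N ⊞ E ⟶ M := biprod.fst ≫ g - a
  have hρ : f' ≫ ρ = 𝟙 M := by
    rw [Preadditive.comp_sub, reassoc_of% hf'₁, ha', sub_sub_cancel]
  let σ := ShortComplex.Splitting.ofExactOfRetraction S hS.exact ρ hρ inferInstance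
  have hσ : σ.s ≫ S.g = 𝟙 _ := σ.s_g
  have hK : Injective S.X₃ := by
    refine injective_of_isStablyZero_id ?_
    have hfl : f ≫ biprod.inl ≫ S.g = -(i ≫ biprod.inr ≫ S.g) := by
      have h : f' ≫ (biprod.fst ≫ biprod.inl + biprod.snd ≫ biprod.inr) ≫ S.g = 0 := by
        rw [biprod.total, Category.id_comp]
        exact S.zero
      rw [Preadditive.add_comp, Preadditive.comp_add, Category.assoc, Category.assoc,
        reassoc_of% hf'₁, reassoc_of% hf'₂] at h
      exact eq_neg_of_add_eq_zero_left h
    -- The cokernel is stably zero: its identity passes through `N ⊞ E`, where the `E`-part is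
    -- stably zero. In the `N`-part, `𝟙 N` may be replaced by `g ≫ f`, and modulo the image of `f'`
    -- the map `f` into `N` equals minus the map `i` into `E`.
    have e : 𝟙 S.X₃ = -((σ.s ≫ biprod.fst) ≫ (g ≫ f - 𝟙 N) ≫ biprod.inl ≫ S.g) -
        (σ.s ≫ biprod.fst ≫ g ≫ i) ≫ biprod.inr ≫ S.g +
        (σ.s ≫ biprod.snd) ≫ biprod.inr ≫ S.g := by
      have h : σ.s ≫ (biprod.fst ≫ biprod.inl + biprod.snd ≫ biprod.inr) ≫ S.g = 𝟙 _ := by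
        rw [biprod.total, Category.id_comp, hσ]
      rw [← h]
      simp only [Preadditive.add_comp, Preadditive.comp_add, Preadditive.sub_comp,
        Preadditive.comp_sub, Category.assoc, hfl, Preadditive.comp_neg, Category.id_comp]
      abel
    rw [e]
    have hE : IsStablyZero (biprod.inr ≫ S.g : E ⟶ S.X₃) := .of_source _
    exact (((hgf.comp_right _).comp_left _).neg.sub (hE.comp_left _)).add (hE.comp_left _)
  have : Injective (X.obj S.X₃) := X.injective_obj_of_injective hK
  -- The retraction becomes one of algebras, since the obstruction starts at the injective `X S.X₃`.
  obtain ⟨φ, hφ, hfφ⟩ := exists_algebra_extension X hS u c k hf' hk u (fun _ => .of_source _) ρ (by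
    rw [show S.f ≫ ρ = 𝟙 M from hρ, X.map_id, Category.id_comp]
    exact (Category.comp_id u).symm)
  replace hfφ : f' ≫ φ = 𝟙 M := hfφ.trans hρ
  have hz : S.f ≫ (𝟙 _ - φ ≫ f') = 0 := by
    change f' ≫ _ = 0
    rw [Preadditive.comp_sub, reassoc_of% hfφ, Category.comp_id, sub_self]
  let s := hS.exact.desc _ hz
  have hs' : S.g ≫ s = 𝟙 _ - φ ≫ f' := hS.exact.g_desc _ hz
  have hsc : X.map s ≫ c = k ≫ s := by
    have : Epi (X.map S.g) := (hS.map_of_exact X).epi_g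
    rw [← cancel_epi (X.map S.g), ← X.map_comp_assoc, reassoc_of% hk, hs', X.map_sub,
      Preadditive.sub_comp, Preadditive.comp_sub, X.map_comp, Category.assoc, hf',
      reassoc_of% hφ, X.map_id, Category.id_comp, Category.comp_id]
  refine ⟨S.X₃, hK, k, inferInstance, biprod.inl ≫ φ, biprod.inr ≫ φ, biprod.inl ≫ S.g,
    s ≫ biprod.fst, ?_, ?_, ?_, ?_, ?_, ?_⟩
  · rw [X.map_comp, Category.assoc, hφ, reassoc_of% hinl]
  · rw [X.map_comp, Category.assoc, hφ, reassoc_of% hinr]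
  · rw [X.map_comp, Category.assoc, hk, reassoc_of% hinl]
  · rw [X.map_comp, Category.assoc, ← hc₁, reassoc_of% hsc]
  · have h : f' ≫ (biprod.fst ≫ biprod.inl + biprod.snd ≫ biprod.inr) ≫ φ = 𝟙 M := by
      rw [biprod.total, Category.id_comp, hfφ]
    rwa [Preadditive.add_comp, Preadditive.comp_add, Category.assoc, Category.assoc,
      reassoc_of% hf'₁, reassoc_of% hf'₂] at h
  · have h : biprod.inl ≫ (φ ≫ f' + S.g ≫ s) ≫ biprod.fst = 𝟙 N := by
      rw [hs', add_sub_cancel, Category.id_comp, biprod.inl_fst]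
    rw [← h]
    simp only [Preadditive.add_comp, Preadditive.comp_add, Category.assoc, hf'₁]

variable [EnoughInjectives C]

/-- If stably zero morphisms of algebras with monic structure maps extend along embeddings into
injective algebras, then `X` sends cosyzygies to injective objects. -/
theorem injective_obj_of_forall_extension
    (h : ∀ (S : ShortComplex C), S.ShortExact → Injective S.X₂ → ∀ (u₁ : X.obj S.X₁ ⟶ S.X₁)
      (u₂ : X.obj S.X₂ ⟶ S.X₂) (u₃ : X.obj S.X₃ ⟶ S.X₃), Mono u₁ → Mono u₂ → Mono u₃ →
      X.map S.f ≫ u₂ = u₁ ≫ S.f → X.map S.g ≫ u₃ = u₂ ≫ S.g →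
      ∀ (N : C) (v : X.obj N ⟶ N), Mono v → ∀ e : S.X₁ ⟶ N, X.map e ≫ v = u₁ ≫ e →
        IsStablyZero e → ∃ φ : S.X₂ ⟶ N, X.map φ ≫ v = u₂ ≫ φ ∧ S.f ≫ φ = e)
    (S : ShortComplex C) (hS : S.ShortExact) (hI : Injective S.X₂) : Injective (X.obj S.X₃) := by
  have := hS.epi_g
  let Y := Injective.under (X.obj S.X₃)
  let j : X.obj S.X₃ ⟶ Y := Injective.ι _
  -- The algebra `S.X₃ ⊞ T(Y)` is the monic replacement of `S.X₃` with zero structure map. It is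
  -- covered by the free algebra on the injective `S.X₂ ⊞ Y`, and the kernel of this cover supplies
  -- the test sequence.
  let k := replacementStr X (0 : X.obj S.X₃ ⟶ S.X₃) j
  let gen : S.X₂ ⊞ Y ⟶ S.X₃ ⊞ (freeFunctor X).obj Y :=
    biprod.desc (S.g ≫ biprod.inl) (freeUnit X Y ≫ biprod.inr)
  let p := freeLift X k gen
  have hp : X.map p ≫ k = freeStr X _ ≫ p := freeLift_comm X k gen
  have hup : freeUnit X _ ≫ p = gen := freeUnit_freeLift X k gen
  -- A lift of the summand `T(Y)` through `p`; the summand `S.X₃` is covered by generators because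
  -- `S.g` is epi.
  let τ := freeLift X (freeStr X (S.X₂ ⊞ Y)) (biprod.inr ≫ freeUnit X _)
  have hτ : τ ≫ p = biprod.inr := by
    refine free_algebra_hom_ext X k ?_ (map_inr_replacementStr X _ _) ?_
    · rw [X.map_comp, Category.assoc, hp, ← Category.assoc, freeLift_comm, Category.assoc]
    · rw [← Category.assoc, freeUnit_freeLift, Category.assoc, hup, biprod.inr_desc]
  have : Epi p := by
    refine Preadditive.epi_of_cancel_zero _ fun {A} z hz => ?_
    ext
    · rw [comp_zero, ← cancel_epi S.g, comp_zero]
      have e := congrArg (biprod.inl ≫ freeUnit X _ ≫ ·) hz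
      simp only [reassoc_of% hup, gen, biprod.inl_desc_assoc, comp_zero, Category.assoc] at e
      exact e
    · rw [← hτ, Category.assoc, hz, comp_zero, comp_zero]
  let R := ShortComplex.mk (kernel.ι p) p (kernel.condition p)
  have hR : R.ShortExact :=
    { exact := R.exact_of_f_is_kernel (kernelIsKernel p)
      mono_f := inferInstanceAs (Mono (kernel.ι p))
      epi_g := this }
  have hz : (X.map (kernel.ι p) ≫ freeStr X (S.X₂ ⊞ Y)) ≫ p = 0 := by
    rw [Category.assoc, ← hp, ← X.map_comp_assoc, kernel.condition, X.map_zero, zero_comp]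
  let u₁ : X.obj (kernel p) ⟶ kernel p := kernel.lift p _ hz
  have hu₁ : u₁ ≫ kernel.ι p = X.map (kernel.ι p) ≫ freeStr X _ := kernel.lift_ι p _ hz
  have hu₁m : Mono u₁ := mono_of_mono_fac hu₁
  have hXE : Injective (X.obj ((freeFunctor X).obj (S.X₂ ⊞ Y))) :=
    X.injective_obj_of_injective inferInstance
  -- The right side starts at an injective, so the equation is solvable on the cover. It vanishes on
  -- the kernel of `p`, so `ψ` restricts there to a morphism of algebras, stably zero since its
  -- source over the cover is injective.
  obtain ⟨ψ, -, hψ⟩ := exists_solution X (freeStr X (S.X₂ ⊞ Y)) (freeStr X (X.obj S.X₃))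
    (X.map p ≫ X.map biprod.fst ≫ freeUnit X _) (.of_source _)
  have he : X.map (kernel.ι p ≫ ψ) ≫ freeStr X (X.obj S.X₃) = u₁ ≫ kernel.ι p ≫ ψ := by
    have e := congrArg (X.map (kernel.ι p) ≫ ·) hψ
    have hι : X.map (kernel.ι p) ≫ X.map p = 0 := by
      rw [← X.map_comp, kernel.condition, X.map_zero]
    simp only [Preadditive.comp_sub, reassoc_of% hι, zero_comp] at e
    rw [reassoc_of% hu₁, X.map_comp, Category.assoc]
    exact (sub_eq_zero.mp e).symm
  obtain ⟨φ, hφ, hφe⟩ := h R hR (inferInstanceAs (Injective ((freeFunctor X).obj _))) u₁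
    (freeStr X _) k hu₁m inferInstance inferInstance hu₁.symm hp _ (freeStr X (X.obj S.X₃))
    inferInstance (kernel.ι p ≫ ψ) he ((IsStablyZero.of_source ψ).comp_left _)
  have hd : R.f ≫ (ψ - φ) = 0 := by
    rw [Preadditive.comp_sub, hφe]
    exact sub_self _
  have := hR.epi_g
  let G := hR.exact.desc _ hd
  have hG : p ≫ G = ψ - φ := hR.exact.g_desc _ hd
  have hXp : Epi (X.map p) := (hR.map_of_exact X).epi_g
  -- Subtracting the extension `φ` lets the solution descend along `p`.
  have key : k ≫ G - X.map G ≫ freeStr X _ = X.map biprod.fst ≫ freeUnit X _ := by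
    rw [← cancel_epi (X.map p), Preadditive.comp_sub, reassoc_of% hp, ← X.map_comp_assoc, hG,
      X.map_sub, Preadditive.comp_sub, Preadditive.sub_comp, ← hψ]
    replace hφ : X.map φ ≫ freeStr X (X.obj S.X₃) = freeStr X _ ≫ φ := hφ
    rw [hφ]
    abel
  -- Restricting to `X S.X₃` and projecting to generators kills the term with `freeStr` and leaves
  -- an identity that factors through `j`.
  have e := congrArg (X.map biprod.inl ≫ · ≫ freeTop X _) key
  simp only [Preadditive.sub_comp, Category.assoc, freeStr_freeTop, comp_zero, sub_zero,
    freeUnit_freeTop, Category.comp_id, ← X.map_comp, biprod.inl_fst, X.map_id] at e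
  rw [← Category.assoc, map_inl_replacementStr, biprod.lift_eq, zero_comp, zero_add,
    Category.assoc, Category.assoc] at e
  exact Retract.injective ⟨j, _, e⟩

end Retraction

/-! ### Categories equivalent to the category of algebras over an endofunctor -/

/-- A presentation of `A` as a category equivalent to the category of algebras over the
endofunctor `X`. -/
structure AlgebraModel {C : Type u} [Category.{v} C] [Preadditive C] (X : C ⥤ C)
    (A : Type u₁) [Category.{v₁} A] [Preadditive A] where
  /-- The underlying object. -/
  fgt : A ⥤ C
  additive : fgt.Additive
  faithful : fgt.Faithful
  /-- The structure map. -/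
  str (M : A) : X.obj (fgt.obj M) ⟶ fgt.obj M
  comm {M N : A} (f : M ⟶ N) : X.map (fgt.map f) ≫ str N = str M ≫ fgt.map f
  exists_hom {M N : A} (g : fgt.obj M ⟶ fgt.obj N) (hg : X.map g ≫ str N = str M ≫ g) :
    ∃ f : M ⟶ N, fgt.map f = g
  exists_obj {M : C} (u : X.obj M ⟶ M) :
    ∃ (N : A) (e : fgt.obj N ≅ M), X.map e.hom ≫ u = str N ≫ e.hom

namespace AlgebraModel

attribute [instance] additive faithful

section ShortExact

variable {C : Type u} [Category.{v} C] [Abelian C] {X : C ⥤ C}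
  {A : Type u₁} [Category.{v₁} A] [Preadditive A] (K : AlgebraModel X A)

theorem comm_assoc {M N : A} (f : M ⟶ N) {Z : C} (h : K.fgt.obj N ⟶ Z) :
    X.map (K.fgt.map f) ≫ K.str N ≫ h = K.str M ≫ K.fgt.map f ≫ h := by
  rw [← Category.assoc, K.comm, Category.assoc]

theorem map_inv_comm {M : C} {u : X.obj M ⟶ M} {N : A} (e : K.fgt.obj N ≅ M)
    (he : X.map e.hom ≫ u = K.str N ≫ e.hom) : X.map e.inv ≫ K.str N = u ≫ e.inv := by
  rw [← cancel_mono e.hom, Category.assoc, ← he, ← X.map_comp_assoc, Category.assoc]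
  simp

theorem mono_str_of_iso {M : C} {u : X.obj M ⟶ M} [Mono u] {N : A} (e : K.fgt.obj N ≅ M)
    (he : X.map e.hom ≫ u = K.str N ≫ e.hom) : Mono (K.str N) := by
  have : Mono (K.str N ≫ e.hom) := he ▸ inferInstance
  exact mono_of_mono (K.str N) e.hom

variable [X.Additive]

/-- The kernel taken in `C` carries an induced structure map, so its inclusion comes from a morphism
of `A`, which `f` annihilates. -/
theorem mono_map {M N : A} (f : M ⟶ N) [Mono f] : Mono (K.fgt.map f) := by
  have hz : (X.map (kernel.ι (K.fgt.map f)) ≫ K.str M) ≫ K.fgt.map f = 0 := by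
    rw [Category.assoc, ← K.comm, ← X.map_comp_assoc, kernel.condition, X.map_zero, zero_comp]
  obtain ⟨Z, e, he⟩ := K.exists_obj (kernel.lift (K.fgt.map f) _ hz)
  obtain ⟨k, hk⟩ := K.exists_hom (e.hom ≫ kernel.ι (K.fgt.map f)) (M := Z) (N := M) (by
    rw [← reassoc_of% he, kernel.lift_ι, X.map_comp, Category.assoc])
  have hkf : k ≫ f = 0 := K.fgt.map_injective (by
    rw [K.fgt.map_comp, hk, Category.assoc, kernel.condition, comp_zero, K.fgt.map_zero])
  have hk0 : k = 0 := by rw [← cancel_mono f, hkf, zero_comp]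
  refine Preadditive.mono_of_kernel_zero ?_
  rw [← cancel_epi e.hom, ← hk, hk0, K.fgt.map_zero, comp_zero]

variable [PreservesFiniteLimits X] [PreservesFiniteColimits X]

/-- By right exactness of `X`, the cokernel in `C` underlies an algebra `Q`; the universal
properties in `A` and in `C` give mutually inverse morphisms between `Q` and `N`. -/
theorem shortExact_of_pair {L M N : A} {f : L ⟶ M} {g : M ⟶ N} (h : IsKernelCokernelPair f g) :
    ∃ w : K.fgt.map f ≫ K.fgt.map g = 0, (ShortComplex.mk _ _ w).ShortExact := by
  obtain ⟨w, ⟨hk⟩, ⟨hc⟩⟩ := h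
  have : Mono f := mono_of_isLimit_fork hk
  have : Epi g := epi_of_isColimit_cofork hc
  have := K.mono_map f
  have w' : K.fgt.map f ≫ K.fgt.map g = 0 := by rw [← K.fgt.map_comp, w, K.fgt.map_zero]
  refine ⟨w', ?_⟩
  let S := ShortComplex.mk (K.fgt.map f) (cokernel.π (K.fgt.map f)) (cokernel.condition _)
  have hS : S.ShortExact :=
    { exact := S.exact_of_g_is_cokernel (cokernelIsCokernel (K.fgt.map f))
      mono_f := this
      epi_g := inferInstanceAs (Epi (cokernel.π (K.fgt.map f))) }
  obtain ⟨u, hu⟩ := exists_cokernel_structure X hS (K.str L) (K.str M) (K.comm f)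
  have : Epi S.g := hS.epi_g
  have : Epi (X.map S.g) := (hS.map_of_exact X).epi_g
  obtain ⟨Q, e, he⟩ := K.exists_obj u
  have he' := K.map_inv_comm e he
  obtain ⟨q, hq⟩ := K.exists_hom (S.g ≫ e.inv) (by
    rw [X.map_comp, Category.assoc, he', reassoc_of% hu])
  have hfq : f ≫ q = 0 := K.fgt.map_injective (by
    rw [K.fgt.map_comp, hq, K.fgt.map_zero]
    change S.f ≫ _ = 0
    rw [S.zero_assoc, zero_comp])
  obtain ⟨t, ht⟩ := CokernelCofork.IsColimit.desc' hc q hfq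
  replace ht : g ≫ t = q := ht
  let d : S.X₃ ⟶ K.fgt.obj N := cokernel.desc _ _ w'
  have hd : S.g ≫ d = K.fgt.map g := cokernel.π_desc _ _ _
  obtain ⟨t', ht'⟩ := K.exists_hom (e.hom ≫ d) (by
    rw [X.map_comp, Category.assoc, ← reassoc_of% he]
    congr 1
    rw [← cancel_epi (X.map S.g), reassoc_of% hu, hd, ← K.comm, ← hd, X.map_comp, Category.assoc])
  have hqt : q ≫ t' = g := K.fgt.map_injective (by
    rw [K.fgt.map_comp, hq, ht', Category.assoc, e.inv_hom_id_assoc, hd])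
  have h₁ : t ≫ t' = 𝟙 N := by rw [← cancel_epi g, reassoc_of% ht, hqt, Category.comp_id]
  have h₂ : K.fgt.map t' ≫ K.fgt.map t = 𝟙 _ := by
    have : Epi (K.fgt.map q) := hq ▸ epi_comp S.g e.inv
    rw [← cancel_epi (K.fgt.map q), ← K.fgt.map_comp, ← K.fgt.map_comp, reassoc_of% hqt, ht,
      Category.comp_id]
  let i : K.fgt.obj Q ≅ K.fgt.obj N :=
    ⟨K.fgt.map t', K.fgt.map t, h₂, by rw [← K.fgt.map_comp, h₁, K.fgt.map_id]⟩
  refine ShortComplex.shortExact_of_iso (S₁ := S)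
    (ShortComplex.isoMk (Iso.refl _) (Iso.refl _) (e.symm ≪≫ i) ?_ ?_) hS
  · exact (Category.id_comp _).trans (Category.comp_id _).symm
  · refine (Category.id_comp _).trans ?_
    change K.fgt.map g = S.g ≫ e.inv ≫ K.fgt.map t'
    rw [ht', e.inv_hom_id_assoc, hd]

/-- The factorizations in `C` are morphisms of algebras, by cancelling the underlying mono of `f`
and `X` applied to the underlying epi of `g`. -/
theorem pair_of_shortExact {L M N : A} {f : L ⟶ M} {g : M ⟶ N}
    (w : K.fgt.map f ≫ K.fgt.map g = 0) (hS : (ShortComplex.mk _ _ w).ShortExact) :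
    IsKernelCokernelPair f g := by
  have hf : Mono (K.fgt.map f) := hS.mono_f
  have hg : Epi (K.fgt.map g) := hS.epi_g
  have hXg : Epi (X.map (K.fgt.map g)) := (hS.map_of_exact X).epi_g
  have : Mono f := K.fgt.mono_of_mono_map hf
  have : Epi g := K.fgt.epi_of_epi_map hg
  refine ⟨K.fgt.map_injective (by rw [K.fgt.map_comp, w, K.fgt.map_zero]), ?_, ?_⟩
  · have H {Z : A} (k : Z ⟶ M) (hk : k ≫ g = 0) : ∃ l : Z ⟶ L, l ≫ f = k := by
      have hk' : K.fgt.map k ≫ K.fgt.map g = 0 := by rw [← K.fgt.map_comp, hk, K.fgt.map_zero]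
      let l : K.fgt.obj Z ⟶ K.fgt.obj L := hS.exact.lift (K.fgt.map k) hk'
      have hl : l ≫ K.fgt.map f = K.fgt.map k := hS.exact.lift_f (K.fgt.map k) hk'
      obtain ⟨l', hl'⟩ := K.exists_hom l (by
        rw [← cancel_mono (K.fgt.map f), Category.assoc, ← K.comm, ← X.map_comp_assoc, hl,
          Category.assoc, hl, K.comm])
      exact ⟨l', K.fgt.map_injective (by rw [K.fgt.map_comp, hl', hl])⟩
    choose l hl using @H
    exact ⟨KernelFork.IsLimit.ofι' f _ fun k hk => ⟨l k hk, hl k hk⟩⟩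
  · have H {Z : A} (k : M ⟶ Z) (hk : f ≫ k = 0) : ∃ l : N ⟶ Z, g ≫ l = k := by
      have hk' : K.fgt.map f ≫ K.fgt.map k = 0 := by rw [← K.fgt.map_comp, hk, K.fgt.map_zero]
      let l : K.fgt.obj N ⟶ K.fgt.obj Z := hS.exact.desc (K.fgt.map k) hk'
      have hl : K.fgt.map g ≫ l = K.fgt.map k := hS.exact.g_desc (K.fgt.map k) hk'
      obtain ⟨l', hl'⟩ := K.exists_hom l (by
        rw [← cancel_epi (X.map (K.fgt.map g)), ← X.map_comp_assoc, hl, K.comm_assoc, hl, K.comm])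
      exact ⟨l', K.fgt.map_injective (by rw [K.fgt.map_comp, hl', hl])⟩
    choose l hl using @H
    exact ⟨CokernelCofork.IsColimit.ofπ' g _ fun k hk => ⟨l k hk, hl k hk⟩⟩

end ShortExact

/-! ### Inflations and injectives of the monomorphism category -/

section Injective

variable {C : Type u} [Category.{v} C] [Abelian C] [EnoughInjectives C] {X : C ⥤ C} [X.Additive]
  [LocallyNilpotent X] [PreservesFiniteLimits X] [PreservesFiniteColimits X]
  [X.PreservesInjectiveObjects]
  {A : Type u₁} [Category.{v₁} A] [Preadditive A] (K : AlgebraModel X A)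
  {P : ObjectProperty A} (hP : ∀ M, P M ↔ Mono (K.str M))

include hP

/-- Every object of the monomorphism category has a strict embedding into an object with injective
underlying object, and this is an inflation. -/
theorem exists_inflation (M : P.FullSubcategory) :
    ∃ (E : P.FullSubcategory) (i : M ⟶ E), Injective (K.fgt.obj E.obj) ∧ IsInflation P i ∧
      ∀ ⦃B : C⦄ (m : B ⟶ K.fgt.obj M.obj) (y : B ⟶ X.obj (K.fgt.obj E.obj)),
        m ≫ K.fgt.map i.hom = y ≫ K.str E.obj → ∃ n, m = n ≫ K.str M.obj := by
  have := (hP M.obj).1 M.property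
  obtain ⟨J, hJ, i, hi, hs⟩ := exists_strict_embedding X (K.str M.obj)
  obtain ⟨E, e, he⟩ := K.exists_obj (freeStr X J)
  have he' := K.map_inv_comm e he
  have hE := K.mono_str_of_iso e he
  obtain ⟨i', hi'⟩ := K.exists_hom (i ≫ e.inv) (by
    rw [X.map_comp, Category.assoc, he', reassoc_of% hi])
  have hs' ⦃B : C⦄ (m : B ⟶ K.fgt.obj M.obj) (y : B ⟶ X.obj (K.fgt.obj E))
      (hm : m ≫ K.fgt.map i' = y ≫ K.str E) : ∃ n, m = n ≫ K.str M.obj := by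
    refine hs m (y ≫ X.map e.hom) ?_
    rw [Category.assoc, he, ← reassoc_of% hm, hi', Category.assoc, e.inv_hom_id, Category.comp_id]
  have := mono_of_strict_comp X (K.str M.obj) (K.str E) (K.fgt.map i') (K.comm i') hs'
  let S := ShortComplex.mk (K.fgt.map i') (cokernel.π (K.fgt.map i')) (cokernel.condition _)
  have hS : S.ShortExact :=
    { exact := S.exact_of_g_is_cokernel (cokernelIsCokernel (K.fgt.map i'))
      mono_f := this
      epi_g := inferInstanceAs (Epi (cokernel.π (K.fgt.map i'))) }
  obtain ⟨u, hu⟩ := exists_cokernel_structure X hS (K.str M.obj) (K.str E) (K.comm i')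
  have hum := mono_of_strict X hS (K.str M.obj) (K.str E) u (K.comm i') hu hs'
  obtain ⟨Q, d, hd⟩ := K.exists_obj u
  have hd' := K.map_inv_comm d hd
  have hQ := K.mono_str_of_iso d hd
  obtain ⟨p, hp⟩ := K.exists_hom (S.g ≫ d.inv) (by
    rw [X.map_comp, Category.assoc, hd', reassoc_of% hu])
  have w : K.fgt.map i' ≫ K.fgt.map p = 0 := by
    rw [hp]
    change S.f ≫ _ = 0
    rw [S.zero_assoc, zero_comp]
  refine ⟨⟨E, (hP E).2 hE⟩, ObjectProperty.homMk i', .of_iso e.symm inferInstance,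
    ⟨⟨Q, (hP Q).2 hQ⟩, ObjectProperty.homMk p, K.pair_of_shortExact w ?_⟩, hs'⟩
  refine ShortComplex.shortExact_of_iso (S₁ := S)
    (ShortComplex.isoMk (Iso.refl _) (Iso.refl _) d.symm ?_ ?_) hS
  · exact (Category.id_comp _).trans (Category.comp_id _).symm
  · exact (Category.id_comp _).trans hp

/-- An exact injective is a retract of the injective algebra in which it embeds. Conversely, a
morphism into an injective object extends in `C`, and the obstruction to extending as algebras has
injective target. -/
theorem exactInjective_iff (I : P.FullSubcategory) :
    exactInjective P I ↔ Injective (K.fgt.obj I.obj) := by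
  constructor
  · intro hI
    obtain ⟨E, i, hE, hi, -⟩ := K.exists_inflation hP I
    obtain ⟨r, hr⟩ := hI i hi (𝟙 I)
    refine Retract.injective (Y := K.fgt.obj E.obj) ⟨K.fgt.map i.hom, K.fgt.map r.hom, ?_⟩
    rw [← K.fgt.map_comp, ← K.fgt.map_id]
    exact congrArg (fun f => K.fgt.map f.hom) hr
  · rintro hI L M i ⟨N, g, hig⟩ φ
    obtain ⟨w, hS⟩ := K.shortExact_of_pair hig
    have := (hP N.obj).1 N.property
    have : Mono (K.fgt.map i.hom) := hS.mono_f
    obtain ⟨ψ, hψ, hiψ⟩ := exists_algebra_extension X hS (K.str L.obj) (K.str M.obj) (K.str N.obj)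
      (K.comm i.hom) (K.comm g.hom) (K.str I.obj) (fun _ => .of_target _)
      (Injective.factorThru (K.fgt.map φ.hom) (K.fgt.map i.hom)) (by
        change X.map (K.fgt.map i.hom ≫ _) ≫ _ = _ ≫ K.fgt.map i.hom ≫ _
        rw [Injective.comp_factorThru, K.comm])
    replace hiψ : K.fgt.map i.hom ≫ ψ = K.fgt.map φ.hom :=
      hiψ.trans (Injective.comp_factorThru (K.fgt.map φ.hom) (K.fgt.map i.hom))
    obtain ⟨ψ', rfl⟩ := K.exists_hom ψ hψ
    refine ⟨ObjectProperty.homMk ψ', ?_⟩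
    ext
    exact K.fgt.map_injective ((K.fgt.map_comp _ _).trans hiψ)

/-- A single inflation out of `M` witnesses all relations between morphisms out of `M`. Transitivity
then follows by adding second factors, without forming direct sums in `P`. -/
theorem exists_factorization {M : P.FullSubcategory} :
    ∃ (E : P.FullSubcategory) (_ : exactInjective P E) (i : M ⟶ E), ∀ {N : P.FullSubcategory}
      (f g : M ⟶ N), factorRel (exactInjective P) f g → ∃ b, f - g = i ≫ b := by
  obtain ⟨E, i, hE, hi, -⟩ := K.exists_inflation hP M
  refine ⟨E, (K.exactInjective_iff hP E).2 hE, i, ?_⟩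
  rintro N f g ⟨Z, hZ, a, b, h⟩
  obtain ⟨c, rfl⟩ := hZ i hi a
  exact ⟨c ≫ b, h.trans (Category.assoc _ _ _)⟩

theorem congruence_exactInjective : Congruence (factorRel (exactInjective P)) where
  equivalence := fun {M N} =>
    { refl := fun f => by
        obtain ⟨E, hE, i, -⟩ := K.exists_factorization hP (M := M)
        exact ⟨E, hE, i, 0, by simp⟩
      symm := by
        rintro f g ⟨Z, hZ, a, b, h⟩
        exact ⟨Z, hZ, a, -b, by rw [Preadditive.comp_neg, ← h, neg_sub]⟩
      trans := by
        intro f g h h₁ h₂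
        obtain ⟨E, hE, i, H⟩ := K.exists_factorization hP (M := M)
        obtain ⟨b, hb⟩ := H f g h₁
        obtain ⟨c, hc⟩ := H g h h₂
        exact ⟨E, hE, i, b + c, by rw [Preadditive.comp_add, ← hb, ← hc, sub_add_sub_cancel]⟩ }
  comp_left := by
    rintro L M N f g g' ⟨Z, hZ, a, b, h⟩
    exact ⟨Z, hZ, f ≫ a, b, by rw [← Preadditive.comp_sub, h, Category.assoc]⟩
  comp_right := by
    rintro L M N f f' g ⟨Z, hZ, a, b, h⟩
    exact ⟨Z, hZ, a, b ≫ g, by rw [← Preadditive.sub_comp, h, Category.assoc]⟩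

end Injective

end AlgebraModel

/-- The functor `Φ` identifies `D` with the category of algebras over the endofunctor of the
stable category of `C` induced by `X`, up to the choice of representatives of structure maps and
morphisms in `C`. -/
structure IsStableModel {C : Type u} [Category.{v} C] [Abelian C] {X : C ⥤ C}
    {A : Type u₁} [Category.{v₁} A] [Preadditive A] (K : AlgebraModel X A)
    {D : Type u₂} [Category.{v₂} D] (Φ : A ⥤ D) : Prop where
  map_eq_iff {M N : A} (f g : M ⟶ N) :
    Φ.map f = Φ.map g ↔ IsStablyZero (K.fgt.map f - K.fgt.map g)
  exists_representative {M N : A} (φ : Φ.obj M ⟶ Φ.obj N) :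
    ∃ f : K.fgt.obj M ⟶ K.fgt.obj N, IsStablyZero (X.map f ≫ K.str N - K.str M ≫ f) ∧
      ∀ g : M ⟶ N, IsStablyZero (K.fgt.map g - f) → Φ.map g = φ
  -- The conditions on `w` and `w'` are those delivered by `exists_mono_replacement`:
  -- representatives of mutually inverse stable isomorphisms compatible with the structure maps.
  exists_structure (d : D) : ∃ (M : C) (u : X.obj M ⟶ M), ∀ (N : A) (w : M ⟶ K.fgt.obj N)
    (w' : K.fgt.obj N ⟶ M), w ≫ w' = 𝟙 M → IsStablyZero (w' ≫ w - 𝟙 _) →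
      IsStablyZero (X.map w ≫ K.str N - u ≫ w) → Nonempty (Φ.obj N ≅ d)

/-! ### The epivalence and the criterion for an equivalence -/

section Epivalence

variable {C : Type u} [Category.{v} C] [Abelian C] {X : C ⥤ C} [X.Additive]
  [LocallyNilpotent X] [X.PreservesInjectiveObjects]
  {A : Type u₁} [Category.{v₁} A] [Preadditive A] (K : AlgebraModel X A)
  {P : ObjectProperty A} (hP : ∀ M, P M ↔ Mono (K.str M))
  {D : Type u₂} [Category.{v₂} D] {Φ : A ⥤ D} (hΦ : IsStableModel K Φ)

include hP hΦ

/-- Only the source needs a monic structure map, since representatives are extended along it. -/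
theorem exists_map_eq {M N : A} (hM : P M) (φ : Φ.obj M ⟶ Φ.obj N) : ∃ f, Φ.map f = φ := by
  obtain ⟨f, hf, H⟩ := hΦ.exists_representative φ
  have := (hP M).1 hM
  obtain ⟨g, hg, hgf⟩ := exists_correction X (K.str M) (K.str N) f hf
  obtain ⟨g', rfl⟩ := K.exists_hom g hg
  exact ⟨g', H g' hgf⟩

theorem full_descend (h : Descends (exactInjective P) (P.ι ⋙ Φ)) : (descend h).Full where
  map_surjective {M N} φ := by
    obtain ⟨f, hf⟩ := exists_map_eq K hP hΦ M.as.property (N := N.as.obj) φ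
    exact ⟨(toQuotient (exactInjective P)).map (X := M.as) (Y := N.as) (ObjectProperty.homMk f),
      hf⟩

variable [EnoughInjectives C]

theorem essSurj_descend (h : Descends (exactInjective P) (P.ι ⋙ Φ)) : (descend h).EssSurj where
  mem_essImage d := by
    obtain ⟨M, u, H⟩ := hΦ.exists_structure d
    obtain ⟨N, v, hv, w, w', h₁, h₂, h₃⟩ := exists_mono_replacement X u
    obtain ⟨N', e, he⟩ := K.exists_obj v
    have he' := K.map_inv_comm e he
    refine ⟨(toQuotient _).obj ⟨N', (hP N').2 (K.mono_str_of_iso e he)⟩,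
      H N' (w ≫ e.inv) (e.hom ≫ w') (by simp [h₁]) ?_ ?_⟩
    · have := (h₂.comp_right e.inv).comp_left e.hom
      simpa using this
    · have := h₃.comp_right e.inv
      rw [Preadditive.sub_comp, Category.assoc, ← he', Category.assoc] at this
      rwa [X.map_comp, Category.assoc]

variable [PreservesFiniteLimits X] [PreservesFiniteColimits X]

theorem descends_of_isStableModel : Descends (exactInjective P) (P.ι ⋙ Φ) := by
  rintro M N f g ⟨Z, hZ, a, b, h⟩
  refine (hΦ.map_eq_iff f.hom g.hom).2 ⟨_, (K.exactInjective_iff hP Z).1 hZ,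
    K.fgt.map a.hom, K.fgt.map b.hom, ?_⟩
  rw [← K.fgt.map_comp, ← K.fgt.map_sub]
  exact congrArg (fun f => K.fgt.map f.hom) h

/-- The given `g` is an inverse only up to morphisms that are stably zero in `C`. The splitting of
`M ⟶ N ⊞ E` replaces it by `r`, with both errors passing through injective algebras. -/
theorem exists_inverse_in_quotient {M N : P.FullSubcategory} (f : M ⟶ N) (g : N ⟶ M)
    (hfg : Φ.map (f ≫ g).hom = Φ.map (𝟙 M.obj)) (hgf : Φ.map (g ≫ f).hom = Φ.map (𝟙 N.obj)) :
    ∃ r : N ⟶ M, factorRel (exactInjective P) (f ≫ r) (𝟙 M) ∧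
      factorRel (exactInjective P) (r ≫ f) (𝟙 N) := by
  obtain ⟨E, i, hE, hi, hs⟩ := K.exists_inflation hP M
  have := (hP N.obj).1 N.property
  have := (hP E.obj).1 E.property
  rw [hΦ.map_eq_iff, ObjectProperty.FullSubcategory.comp_hom, K.fgt.map_comp,
    K.fgt.map_id] at hfg hgf
  obtain ⟨Q, hQ, k, hk, r, t, q, s, hr, ht, hq, hs, h₁, h₂⟩ := exists_inverse_modulo_injective X
    (K.str M.obj) (K.str N.obj) (K.str E.obj) (K.fgt.map f.hom) (K.comm f.hom)
    (K.fgt.map i.hom) (K.comm i.hom) hs (K.fgt.map g.hom) hfg hgf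
  obtain ⟨Q', e, he⟩ := K.exists_obj k
  have he' := K.map_inv_comm e he
  obtain ⟨r, rfl⟩ := K.exists_hom r hr
  obtain ⟨t, rfl⟩ := K.exists_hom t ht
  obtain ⟨q', hq'⟩ := K.exists_hom (q ≫ e.inv) (by
    rw [X.map_comp, Category.assoc, he', reassoc_of% hq])
  obtain ⟨s', hs'⟩ := K.exists_hom (e.hom ≫ s) (by
    rw [X.map_comp, Category.assoc, hs, reassoc_of% he])
  let Z : P.FullSubcategory := ⟨Q', (hP Q').2 (K.mono_str_of_iso e he)⟩
  have hZ : Injective (K.fgt.obj Q') := .of_iso e.symm hQ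
  refine ⟨ObjectProperty.homMk r,
    ⟨E, (K.exactInjective_iff hP E).2 hE, i, -ObjectProperty.homMk t, ?_⟩,
    ⟨Z, (K.exactInjective_iff hP Z).2 hZ, ObjectProperty.homMk q', -ObjectProperty.homMk s', ?_⟩⟩
  · have h : f.hom ≫ r + i.hom ≫ t = 𝟙 M.obj := K.fgt.map_injective (by
      rw [K.fgt.map_add, K.fgt.map_comp, K.fgt.map_comp, h₁, K.fgt.map_id])
    ext
    change f.hom ≫ r - 𝟙 M.obj = i.hom ≫ (-t)
    rw [← h, Preadditive.comp_neg]
    abel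
  · have h : r ≫ f.hom + q' ≫ s' = 𝟙 N.obj := K.fgt.map_injective (by
      rw [K.fgt.map_add, K.fgt.map_comp, K.fgt.map_comp, hq', hs', Category.assoc,
        e.inv_hom_id_assoc, h₂, K.fgt.map_id])
    ext
    change r ≫ f.hom - 𝟙 N.obj = q' ≫ (-s')
    rw [← h, Preadditive.comp_neg]
    abel

theorem reflectsIsomorphisms_descend (h : Descends (exactInjective P) (P.ι ⋙ Φ)) :
    (descend h).ReflectsIsomorphisms where
  reflects {M N} f hf := by
    obtain ⟨f, rfl⟩ := (toQuotient (exactInjective P)).map_surjective (X := M.as) (Y := N.as) f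
    replace hf : IsIso (Φ.map f.hom) := hf
    obtain ⟨g, hg⟩ := exists_map_eq K hP hΦ N.as.property (inv (Φ.map f.hom))
    obtain ⟨r, h₁, h₂⟩ := exists_inverse_in_quotient K hP hΦ f (ObjectProperty.homMk g)
      (by
        rw [ObjectProperty.FullSubcategory.comp_hom, Φ.map_comp, Φ.map_id]
        exact (congrArg (Φ.map f.hom ≫ ·) hg).trans (IsIso.hom_inv_id _))
      (by
        rw [ObjectProperty.FullSubcategory.comp_hom, Φ.map_comp, Φ.map_id]
        exact (congrArg (· ≫ Φ.map f.hom) hg).trans (IsIso.inv_hom_id _))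
    exact ⟨(toQuotient (exactInjective P)).map r, CategoryTheory.Quotient.sound _ h₁,
      CategoryTheory.Quotient.sound _ h₂⟩

/-- The difference of two stably equal morphisms extends in `C` over an embedding into an injective
algebra `E`. The obstruction to a morphism of algebras starts at `X Q` with `Q` the cokernel, a
cosyzygy. -/
theorem faithful_descend (h : Descends (exactInjective P) (P.ι ⋙ Φ))
    (hX : ∀ S : ShortComplex C, S.ShortExact → Injective S.X₂ → Injective (X.obj S.X₃)) :
    (descend h).Faithful where
  map_injective {M N} f g hfg := by
    obtain ⟨f, rfl⟩ := (toQuotient (exactInjective P)).map_surjective (X := M.as) (Y := N.as) f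
    obtain ⟨g, rfl⟩ := (toQuotient (exactInjective P)).map_surjective (X := M.as) (Y := N.as) g
    replace hfg : Φ.map f.hom = Φ.map g.hom := hfg
    rw [hΦ.map_eq_iff, ← K.fgt.map_sub] at hfg
    obtain ⟨E, i, hE, ⟨Q, p, hip⟩, -⟩ := K.exists_inflation hP M.as
    obtain ⟨w, hS⟩ := K.shortExact_of_pair hip
    have : Mono (K.fgt.map i.hom) := hS.mono_f
    obtain ⟨ψ, -, hψ⟩ := hfg.exists_extension (K.fgt.map i.hom)
    have := (hP Q.obj).1 Q.property
    have hXQ := hX _ hS hE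
    obtain ⟨φ, hφ, hiφ⟩ := exists_algebra_extension X hS (K.str M.as.obj) (K.str E.obj)
      (K.str Q.obj) (K.comm i.hom) (K.comm p.hom) (K.str N.as.obj)
      (fun h => .of_source (hM := hXQ) h) ψ (by
        change X.map (K.fgt.map i.hom ≫ ψ) ≫ _ = _ ≫ K.fgt.map i.hom ≫ ψ
        rw [hψ, K.comm])
    obtain ⟨φ, rfl⟩ := K.exists_hom φ hφ
    refine CategoryTheory.Quotient.sound _ ⟨E, (K.exactInjective_iff hP E).2 hE, i, ObjectProperty.homMk φ, ?_⟩
    ext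
    refine K.fgt.map_injective ?_
    change K.fgt.map (f.hom - g.hom) = K.fgt.map (i.hom ≫ φ)
    rw [K.fgt.map_comp]
    exact (hiφ.trans hψ).symm

theorem injective_obj_of_faithful (h : Descends (exactInjective P) (P.ι ⋙ Φ))
    (hf : (descend h).Faithful) (S : ShortComplex C) (hS : S.ShortExact) (hI : Injective S.X₂) :
    Injective (X.obj S.X₃) := by
  refine injective_obj_of_forall_extension X ?_ S hS hI
  intro S hS _ u₁ u₂ u₃ _ _ _ hu₁ hu₂ N v _ e he he₀
  obtain ⟨M', a, ha⟩ := K.exists_obj u₁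
  obtain ⟨N', b, hb⟩ := K.exists_obj v
  have ha' := K.map_inv_comm a ha
  have hb' := K.map_inv_comm b hb
  obtain ⟨e', he'⟩ := K.exists_hom (a.hom ≫ e ≫ b.inv) (by
    rw [X.map_comp, X.map_comp, Category.assoc, Category.assoc, hb', reassoc_of% he,
      reassoc_of% ha])
  let M : P.FullSubcategory := ⟨M', (hP M').2 (K.mono_str_of_iso a ha)⟩
  let N : P.FullSubcategory := ⟨N', (hP N').2 (K.mono_str_of_iso b hb)⟩
  let f : M ⟶ N := ObjectProperty.homMk e'
  have hf₀ : (toQuotient (exactInjective P)).map f = (toQuotient (exactInjective P)).map 0 := by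
    refine (descend h).map_injective ((hΦ.map_eq_iff e' 0).2 ?_)
    rw [he', K.fgt.map_zero, sub_zero]
    exact (he₀.comp_right _).comp_left _
  have := K.congruence_exactInjective hP
  rw [Quotient.functor_map_eq_iff] at hf₀
  obtain ⟨Z, hZ, c, d, hcd⟩ := hf₀
  have : Injective (K.fgt.obj Z.obj) := (K.exactInjective_iff hP Z).1 hZ
  have := hS.mono_f
  -- Faithfulness made `e` factor through the exact injective `Z`; extending the first factor
  -- extends `e`.
  obtain ⟨φ, hφ, hφ'⟩ := exists_algebra_extension X hS u₁ u₂ u₃ hu₁ hu₂ (K.str Z.obj)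
    (fun _ => .of_target _) (Injective.factorThru (a.inv ≫ K.fgt.map c.hom) S.f) (by
      rw [Injective.comp_factorThru, X.map_comp, Category.assoc, K.comm, reassoc_of% ha'])
  rw [Injective.comp_factorThru] at hφ'
  refine ⟨φ ≫ K.fgt.map d.hom ≫ b.hom, ?_, ?_⟩
  · rw [X.map_comp, X.map_comp, Category.assoc, Category.assoc, hb, K.comm_assoc, reassoc_of% hφ]
  · have h₁ : K.fgt.map c.hom ≫ K.fgt.map d.hom = a.hom ≫ e ≫ b.inv := by
      rw [← he', ← K.fgt.map_comp]
      have := congrArg (fun f => K.fgt.map f.hom) hcd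
      rw [sub_zero] at this
      exact this.symm
    rw [reassoc_of% hφ', reassoc_of% h₁]
    simp

/-- The functor from the stable monomorphism category to the category of algebras over the
stable category is an epivalence, and it is an equivalence if and only if `X` sends cosyzygies to
injective objects. -/
theorem exists_isEpivalence_descend : ∃ h : Descends (exactInjective P) (P.ι ⋙ Φ),
    IsEpivalence (descend h) ∧ ((descend h).IsEquivalence ↔
      ∀ S : ShortComplex C, S.ShortExact → Injective S.X₂ → Injective (X.obj S.X₃)) := by
  refine ⟨descends_of_isStableModel K hP hΦ, ⟨full_descend K hP hΦ _, essSurj_descend K hP hΦ _,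
    reflectsIsomorphisms_descend K hP hΦ _⟩, fun h => ?_, fun h => ?_⟩
  · exact injective_obj_of_faithful K hP hΦ _ h.faithful
  · exact { full := full_descend K hP hΦ _
            essSurj := essSurj_descend K hP hΦ _
            faithful := faithful_descend K hP hΦ _ h }

end Epivalence

/-! ### Modules over the free monad -/

section FreeMonadModel

variable {C : Type u} [Category.{v} C] [Abelian C] (X : C ⥤ C) [X.Additive] [LocallyNilpotent X]

theorem freeUnit_map {M N : C} (f : M ⟶ N) :
    freeUnit X M ≫ (freeFunctor X).map f = f ≫ freeUnit X N :=
  inc_map X f 0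

/-- The restriction of a morphism out of the coproduct of all `X ^ i M` to the summand `X M`. -/
def restr {M N : C} (a : (freeFunctor X).obj M ⟶ N) : X.obj M ⟶ N :=
  inc X M 1 ≫ a

theorem restr_comp {L M N : C} (a : (freeFunctor X).obj L ⟶ M) (f : M ⟶ N) :
    restr X (a ≫ f) = restr X a ≫ f :=
  (Category.assoc _ _ _).symm

theorem restr_sub {M N : C} (a b : (freeFunctor X).obj M ⟶ N) :
    restr X (a - b) = restr X a - restr X b :=
  Preadditive.comp_sub _ _ _

theorem restr_freeMul (M : C) : restr X (freeMul X M) = freeStr X M :=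
  rfl

theorem map_restr {L M N : C} (f : L ⟶ M) (g : (freeFunctor X).obj M ⟶ N) :
    X.map f ≫ restr X g = restr X ((freeFunctor X).map f ≫ g) := by
  have h := congrArg (· ≫ g) (inc_map X f 1)
  simp only [Category.assoc] at h
  exact h.symm

theorem IsStablyZero.restr {M N : C} {a : (freeFunctor X).obj M ⟶ N} (ha : IsStablyZero a) :
    IsStablyZero (restr X a) :=
  ha.comp_left _

theorem map_freeMul_freeStr (M : C) :
    X.map (freeMul X M) ≫ freeStr X M = freeStr X ((freeFunctor X).obj M) ≫ freeMul X M := by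
  rw [← restr_freeMul, ← restr_freeMul, map_restr, ← restr_comp]
  exact congrArg (restr X) ((freeMonad X).assoc M)

theorem map_map_freeStr {M N : C} (f : M ⟶ N) :
    X.map ((freeFunctor X).map f) ≫ freeStr X N = freeStr X M ≫ (freeFunctor X).map f := by
  rw [← restr_freeMul, ← restr_freeMul, map_restr, ← restr_comp]
  exact congrArg (restr X) ((freeMonad X).μ.naturality f)

theorem freeUnit_freeMul (M : C) : freeUnit X ((freeFunctor X).obj M) ≫ freeMul X M = 𝟙 _ :=
  (freeMonad X).left_unit M

theorem map_comp_restr {M : C} {a : (freeFunctor X).obj M ⟶ M}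
    (ha : freeMul X M ≫ a = (freeFunctor X).map a ≫ a) :
    X.map a ≫ restr X a = freeStr X M ≫ a := by
  rw [map_restr, ← ha, restr_comp, restr_freeMul]

theorem map_map_comp_restr {M N : C} {b : (freeFunctor X).obj N ⟶ N}
    (hb : freeMul X N ≫ b = (freeFunctor X).map b ≫ b) (g : M ⟶ N) :
    X.map ((freeFunctor X).map g ≫ b) ≫ restr X b = freeStr X M ≫ (freeFunctor X).map g ≫ b := by
  rw [X.map_comp, Category.assoc, map_comp_restr X hb, ← Category.assoc, map_map_freeStr,
    Category.assoc]

theorem freeUnit_map_comp {M N : C} {b : (freeFunctor X).obj N ⟶ N} (hb : freeUnit X N ≫ b = 𝟙 N)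
    (g : M ⟶ N) : freeUnit X M ≫ (freeFunctor X).map g ≫ b = g := by
  rw [← Category.assoc, freeUnit_map, Category.assoc, hb, Category.comp_id]

/-- Both sides are morphisms of `X`-algebras out of a free algebra and agree on generators. -/
theorem map_comp_eq_of_restr {M N : C} {a : (freeFunctor X).obj M ⟶ M}
    {b : (freeFunctor X).obj N ⟶ N} (ha : freeUnit X M ≫ a = 𝟙 M)
    (ha' : freeMul X M ≫ a = (freeFunctor X).map a ≫ a) (hb : freeUnit X N ≫ b = 𝟙 N)
    (hb' : freeMul X N ≫ b = (freeFunctor X).map b ≫ b) (g : M ⟶ N)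
    (hg : X.map g ≫ restr X b = restr X a ≫ g) : (freeFunctor X).map g ≫ b = a ≫ g := by
  refine free_algebra_hom_ext X (restr X b) (map_map_comp_restr X hb' g) ?_ ?_
  · rw [X.map_comp, Category.assoc, hg, ← Category.assoc, map_comp_restr X ha', Category.assoc]
  · rw [freeUnit_map_comp X hb, ← Category.assoc, ha, Category.id_comp]

theorem freeMul_freeLift {M : C} (u : X.obj M ⟶ M) :
    freeMul X M ≫ freeLift X u (𝟙 M) =
      (freeFunctor X).map (freeLift X u (𝟙 M)) ≫ freeLift X u (𝟙 M) := by
  refine free_algebra_hom_ext X u ?_ ?_ ?_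
  · rw [X.map_comp, Category.assoc, freeLift_comm, ← Category.assoc, map_freeMul_freeStr,
      Category.assoc]
  · rw [X.map_comp, Category.assoc, freeLift_comm, ← Category.assoc, map_map_freeStr,
      Category.assoc]
  · rw [← Category.assoc, freeUnit_freeMul, ← Category.assoc, freeUnit_map,
      Category.assoc, freeUnit_freeLift, Category.comp_id, Category.id_comp]

theorem restr_freeLift {M : C} (u : X.obj M ⟶ M) : restr X (freeLift X u (𝟙 M)) = u := by
  refine (inc_freeDesc X (powMap X u (𝟙 M)) 1).trans ?_
  exact (congrArg (· ≫ u) (X.map_id M)).trans (Category.id_comp u)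

/-- The module over the free monad given by a structure map `X M ⟶ M`. -/
def freeMonadAlgebra {M : C} (u : X.obj M ⟶ M) : (freeMonad X).Algebra where
  A := M
  a := freeLift X u (𝟙 M)
  unit := freeUnit_freeLift X u (𝟙 M)
  assoc := freeMul_freeLift X u

/-- The Eilenberg-Moore category of the free monad of `X` as a category of algebras over `X`. -/
def freeMonadModel : AlgebraModel X (freeMonad X).Algebra where
  fgt := (freeMonad X).forget
  additive := inferInstance
  faithful := inferInstance
  str := structureMap X
  comm {M N} f := by
    refine (map_restr X f.f N.a).trans ?_
    exact (congrArg (restr X) f.h).trans (restr_comp X M.a f.f)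
  exists_hom {M N} g hg :=
    ⟨⟨g, map_comp_eq_of_restr X M.unit M.assoc N.unit N.assoc g hg⟩, rfl⟩
  exists_obj {M} u := by
    refine ⟨freeMonadAlgebra X u, Iso.refl M, ?_⟩
    refine (congrArg (· ≫ u) (X.map_id M)).trans ((Category.id_comp u).trans ?_)
    exact (restr_freeLift X u).symm.trans (Category.comp_id _).symm

variable {X} in
-- Only finitely many summands are nonzero, so a finite biproduct of the chosen injectives suffices.
theorem isStablyZero_of_inc {M N : C} (f : (freeFunctor X).obj M ⟶ N)
    (h : ∀ j, IsStablyZero (inc X M j ≫ f)) : IsStablyZero f := by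
  have := Abelian.hasFiniteBiproducts (C := C)
  obtain ⟨n, hn⟩ := exists_forall_isZero X M
  choose Z hZ a b hab using h
  let α : (freeFunctor X).obj M ⟶ ⨁ fun k : Fin n => Z k := freeDesc X fun j =>
    if hj : j < n then a j ≫ biproduct.ι (fun k : Fin n => Z k) ⟨j, hj⟩ else 0
  refine ⟨⨁ fun k : Fin n => Z k, inferInstance, α, biproduct.desc fun k => b k, ?_⟩
  refine free_hom_ext fun j => ?_
  by_cases hj : j < n
  · rw [hab, ← Category.assoc, inc_freeDesc, dif_pos hj, Category.assoc, biproduct.ι_desc]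
  · exact (hn j (not_lt.1 hj)).eq_of_src _ _

theorem isStablyZero_restr_sub {M N : C} {a : (freeFunctor X).obj M ⟶ M}
    {b : (freeFunctor X).obj N ⟶ N} {f : M ⟶ N}
    (h : IsStablyZero ((freeFunctor X).map f ≫ b - a ≫ f)) :
    IsStablyZero (X.map f ≫ restr X b - restr X a ≫ f) := by
  have h' := h.restr X
  rwa [restr_sub, ← map_restr, restr_comp] at h'

variable [X.PreservesInjectiveObjects]

/-- A morphism out of a free algebra which respects the structure maps up to stably zero morphisms
is determined, up to a stably zero morphism, by its restriction to the generators. -/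
theorem isStablyZero_sub_of_free {M N : C} (v : X.obj N ⟶ N) {f g : (freeFunctor X).obj M ⟶ N}
    (hf : IsStablyZero (X.map f ≫ v - freeStr X M ≫ f))
    (hg : IsStablyZero (X.map g ≫ v - freeStr X M ≫ g))
    (h : IsStablyZero (freeUnit X M ≫ (f - g))) : IsStablyZero (f - g) := by
  refine isStablyZero_of_inc _ fun j => ?_
  induction j with
  | zero => exact h
  | succ j ih =>
      have e : X.map (inc X M j) ≫ freeStr X M = inc X M (j + 1) := map_inc_one X M j
      have h₁ : X.map (inc X M j) ≫ freeStr X M ≫ (f - g) =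
          X.map (inc X M j ≫ (f - g)) ≫ v -
            X.map (inc X M j) ≫ ((X.map f ≫ v - freeStr X M ≫ f) -
              (X.map g ≫ v - freeStr X M ≫ g)) := by
        simp only [X.map_comp, X.map_sub, Preadditive.comp_sub, Preadditive.sub_comp,
          Category.assoc]
        abel
      have h₂ : IsStablyZero (X.map (inc X M j) ≫ freeStr X M ≫ (f - g)) := by
        rw [h₁]
        exact ((ih.map X).comp_right v).sub ((hf.sub hg).comp_left _)
      rw [← Category.assoc] at h₂
      exact (congrArg (fun t => IsStablyZero (t ≫ (f - g))) e).mp h₂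

/-- The analogue of `map_comp_eq_of_restr` modulo injectives: `α` represents a module over the monad
on the stable category, so its unit and associativity laws hold only up to stably zero morphisms. -/
theorem isStablyZero_map_comp_sub {M N : C} {α : (freeFunctor X).obj M ⟶ M}
    {b : (freeFunctor X).obj N ⟶ N} (hα : IsStablyZero (freeUnit X M ≫ α - 𝟙 M))
    (hα' : IsStablyZero (freeMul X M ≫ α - (freeFunctor X).map α ≫ α))
    (hb : freeUnit X N ≫ b = 𝟙 N) (hb' : freeMul X N ≫ b = (freeFunctor X).map b ≫ b) (w : M ⟶ N)
    (hw : IsStablyZero (X.map w ≫ restr X b - restr X α ≫ w)) :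
    IsStablyZero ((freeFunctor X).map w ≫ b - α ≫ w) := by
  refine isStablyZero_sub_of_free X (restr X b) ?_ ?_ ?_
  · rw [map_map_comp_restr X hb', sub_self]
    exact .zero _ _
  · have e := (hw.comp_left (X.map α)).sub ((hα'.restr X).comp_right w)
    rw [restr_sub, restr_comp, restr_freeMul, ← map_restr] at e
    convert e using 1
    simp only [X.map_comp, Preadditive.comp_sub, Preadditive.sub_comp, Category.assoc]
    abel
  · rw [Preadditive.comp_sub, freeUnit_map_comp X hb]
    have := (hα.comp_right w).neg
    rwa [Preadditive.sub_comp, neg_sub, Category.id_comp, Category.assoc] at this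

theorem isStableModel_freeMonad : IsStableModel (freeMonadModel X)
    (algebraToQuotient (isInjective C) (freeMonad X) (injective_free X)) where
  map_eq_iff {M N} f g := by
    refine Iff.trans ?_ (toStable_map_eq_iff f.f g.f)
    exact ⟨fun h => congrArg Monad.Algebra.Hom.f h, fun h => Monad.Algebra.Hom.ext h⟩
  exists_representative {M N} φ := by
    obtain ⟨f, hf⟩ := (toStable C).map_surjective (X := M.A) (Y := N.A) φ.f
    refine ⟨f, ?_, fun g hg => Monad.Algebra.Hom.ext ?_⟩
    · have h' := φ.h
      rw [← hf] at h'
      exact isStablyZero_restr_sub X (N := N.A) (a := M.a) (b := N.a)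
        ((toStable_map_eq_iff ((freeFunctor X).map f ≫ N.a) (M.a ≫ f)).1 h')
    · exact ((toStable_map_eq_iff g.f f).2 hg).trans hf
  exists_structure d := by
    obtain ⟨α, hα⟩ := (toStable C).map_surjective (X := (freeFunctor X).obj d.A.as) (Y := d.A.as)
      d.a
    refine ⟨d.A.as, restr X α, fun N w w' h₁ h₂ h₃ => ?_⟩
    have hunit : IsStablyZero (freeUnit X d.A.as ≫ α - 𝟙 _) := by
      rw [← toStable_map_eq_iff]
      refine ((toStable C).map_comp (freeUnit X d.A.as) α).trans ?_
      rw [hα]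
      exact d.unit
    have hassoc : IsStablyZero (freeMul X d.A.as ≫ α - (freeFunctor X).map α ≫ α) := by
      rw [← toStable_map_eq_iff]
      have h := d.assoc
      rw [← hα] at h
      exact h
    have key := isStablyZero_map_comp_sub X (N := N.A) hunit hassoc N.unit N.assoc w h₃
    let i : d.A ≅ (toStable C).obj N.A :=
      { hom := (toStable C).map (X := d.A.as) (Y := N.A) w
        inv := (toStable C).map (X := N.A) (Y := d.A.as) w'
        hom_inv_id := (congrArg (toStable C).map h₁ :)
        inv_hom_id := (toStable_map_eq_iff (w' ≫ w) (𝟙 N.A)).2 h₂ }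
    refine ⟨(Monad.Algebra.isoMk (A := d) (B := (algebraToQuotient (isInjective C) (freeMonad X)
      (injective_free X)).obj N) i ?_).symm⟩
    rw [← hα]
    exact (toStable_map_eq_iff ((freeFunctor X).map w ≫ N.a) (α ≫ w)).2 key

end FreeMonadModel

/-! ### Cosyzygies and injective dimension -/

section InjectiveDimension

variable {C : Type u} [Category.{v} C] [Abelian C] (X : C ⥤ C) [X.Additive]
  [PreservesFiniteLimits X] [PreservesFiniteColimits X] [X.PreservesInjectiveObjects]

/-- Dimension shifting along `X` applied to a short exact sequence with injective middle term. -/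
theorem forall_hasInjectiveDimensionLE_one_iff [EnoughInjectives C] :
    (∀ M : C, HasInjectiveDimensionLE (X.obj M) 1) ↔
      ∀ S : ShortComplex C, S.ShortExact → Injective S.X₂ → Injective (X.obj S.X₃) := by
  have key (S : ShortComplex C) (hS : S.ShortExact) (h : Injective S.X₂) :
      Injective (X.obj S.X₃) ↔ HasInjectiveDimensionLE (X.obj S.X₁) 1 := by
    rw [injective_iff_hasInjectiveDimensionLT_one]
    exact (hS.map_of_exact X).hasInjectiveDimensionLT_X₃_iff 0 (X.injective_obj_of_injective h)
  constructor
  · intro h S hS hI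
    exact (key S hS hI).2 (h S.X₁)
  · intro h M
    let S := ShortComplex.mk (Injective.ι M) (cokernel.π (Injective.ι M)) (cokernel.condition _)
    have hS : S.ShortExact :=
      { exact := S.exact_of_g_is_cokernel (cokernelIsCokernel (Injective.ι M))
        mono_f := inferInstanceAs (Mono (Injective.ι M))
        epi_g := inferInstanceAs (Epi (cokernel.π (Injective.ι M))) }
    have hI : Injective S.X₂ := inferInstanceAs (Injective (Injective.under M))
    exact (key S hS hI).1 (h S hS hI)

variable [EnoughInjectives C] [LocallyNilpotent X]

theorem exists_isEpivalence_monoToStable :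
    ∃ h : Descends (exactInjective (monoProp X)) (monoToStable X),
      IsEpivalence (descend h) ∧
      ((descend h).IsEquivalence ↔ ∀ M : C, HasInjectiveDimensionLE (X.obj M) 1) ∧
      (IsHereditary C → (descend h).IsEquivalence) := by
  obtain ⟨h, he, hi⟩ := exists_isEpivalence_descend (freeMonadModel X) (P := monoProp X)
    (fun _ => Iff.rfl) (isStableModel_freeMonad X)
  refine ⟨h, he, hi.trans (forall_hasInjectiveDimensionLE_one_iff X).symm, fun hC => hi.2 ?_⟩
  exact fun S hS hI => X.injective_obj_of_injective (hC S hS hI)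

end InjectiveDimension

/-! ### Families of objects and the functor summing over incoming arrows -/

section ArrowFunctor

attribute [local instance] Abelian.hasFiniteBiproducts

variable {V : Type u₁} {B : Type u} [Category.{v} B]

theorem discrete_hom_ext {M N : Discrete V ⥤ B} {f g : M ⟶ N}
    (h : ∀ i : V, f.app ⟨i⟩ = g.app ⟨i⟩) : f = g :=
  NatTrans.ext (funext fun i => h i.as)

section Injective

theorem injective_of_app [Abelian B] (M : Discrete V ⥤ B) (h : ∀ i : V, Injective (M.obj ⟨i⟩)) :
    Injective M where
  factors {K L} g f _ := by
    have hi (i : Discrete V) : Injective (M.obj i) := h i.as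
    refine ⟨Discrete.natTrans fun i => Injective.factorThru (g.app i) (f.app i), ?_⟩
    refine discrete_hom_ext fun i => ?_
    exact Injective.comp_factorThru (g.app ⟨i⟩) (f.app ⟨i⟩)

variable [EnoughInjectives B]

/-- A componentwise injective hull. -/
def componentwiseUnder (M : Discrete V ⥤ B) : Discrete V ⥤ B :=
  Discrete.functor fun i => Injective.under (M.obj ⟨i⟩)

instance componentwiseUnder_obj_injective (M : Discrete V ⥤ B) (i : V) :
    Injective ((componentwiseUnder M).obj ⟨i⟩) :=
  inferInstanceAs (Injective (Injective.under (M.obj ⟨i⟩)))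

/-- The embedding into a componentwise injective hull. -/
def componentwiseι (M : Discrete V ⥤ B) : M ⟶ componentwiseUnder M :=
  Discrete.natTrans fun i => (Injective.ι (M.obj i) :)

instance mono_componentwiseι (M : Discrete V ⥤ B) : Mono (componentwiseι M) := by
  have (i : Discrete V) : Mono ((componentwiseι M).app i) :=
    inferInstanceAs (Mono (Injective.ι (M.obj i)))
  exact NatTrans.mono_of_mono_app _

theorem injective_app (M : Discrete V ⥤ B) [h : Injective M] (i : V) : Injective (M.obj ⟨i⟩) := by
  have e := Injective.comp_factorThru (𝟙 M) (componentwiseι M)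
  refine Retract.injective (Y := (componentwiseUnder M).obj ⟨i⟩) ⟨(componentwiseι M).app ⟨i⟩,
    (Injective.factorThru (𝟙 M) (componentwiseι M)).app ⟨i⟩, ?_⟩
  rw [← NatTrans.comp_app, e, NatTrans.id_app]

variable [Abelian B]

instance enoughInjectives_discrete : EnoughInjectives (Discrete V ⥤ B) where
  presentation M := ⟨{
    J := componentwiseUnder M
    injective := injective_of_app _ fun _ => inferInstance
    f := componentwiseι M }⟩

theorem isStablyZero_iff_app {M N : Discrete V ⥤ B} (f : M ⟶ N) :
    IsStablyZero f ↔ ∀ i : V, IsStablyZero (f.app ⟨i⟩) := by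
  constructor
  · rintro ⟨Z, hZ, a, b, rfl⟩ i
    exact ⟨_, injective_app Z i, a.app ⟨i⟩, b.app ⟨i⟩, NatTrans.comp_app _ _ _⟩
  · intro h
    choose Z hZ a b hab using h
    refine ⟨Discrete.functor Z, injective_of_app _ hZ, Discrete.natTrans fun i => a i.as,
      Discrete.natTrans fun i => b i.as, discrete_hom_ext hab⟩

end Injective

variable [Abelian B]

theorem biproduct_map_comp {J : Type*} [Finite J] {F G H : J → B} (f : ∀ j, F j ⟶ G j)
    (g : ∀ j, G j ⟶ H j) :
    biproduct.map (fun j => f j ≫ g j) = biproduct.map f ≫ biproduct.map g := by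
  ext
  simp

variable (E : V → V → Type v₁) [∀ i, Finite (Σ j, E j i)]

/-- The endofunctor which sends a family `M` to the family of direct sums of all `M j` over the
elements of `E j i`. -/
def arrowFunctor : (Discrete V ⥤ B) ⥤ (Discrete V ⥤ B) where
  obj M := Discrete.functor fun i => ⨁ fun α : Σ j, E j i => M.obj ⟨α.1⟩
  map f := Discrete.natTrans fun i => biproduct.map fun α : Σ j, E j i.as => f.app ⟨α.1⟩
  map_id M := discrete_hom_ext fun i => biproduct.hom_ext' _ _ fun α =>
    (biproduct.ι_map (fun α : Σ j, E j i => 𝟙 (M.obj ⟨α.1⟩)) α).trans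
      ((Category.id_comp _).trans (Category.comp_id _).symm)
  map_comp f g := discrete_hom_ext fun i =>
    biproduct_map_comp (fun α : Σ j, E j i => f.app ⟨α.1⟩) fun α => g.app ⟨α.1⟩

variable {E}

/-- The inclusion of a summand. -/
def arrowι (M : Discrete V ⥤ B) {i j : V} (a : E j i) :
    M.obj ⟨j⟩ ⟶ ((arrowFunctor E).obj M).obj ⟨i⟩ :=
  biproduct.ι (fun α : Σ j, E j i => M.obj ⟨α.1⟩) ⟨j, a⟩

/-- The projection onto a summand. -/
def arrowπ (M : Discrete V ⥤ B) {i j : V} (a : E j i) :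
    ((arrowFunctor E).obj M).obj ⟨i⟩ ⟶ M.obj ⟨j⟩ :=
  biproduct.π (fun α : Σ j, E j i => M.obj ⟨α.1⟩) ⟨j, a⟩

theorem arrowι_arrowπ_self (M : Discrete V ⥤ B) {i j : V} (a : E j i) :
    arrowι M a ≫ arrowπ M a = 𝟙 _ :=
  biproduct.ι_π_self (fun α : Σ j, E j i => M.obj ⟨α.1⟩) ⟨j, a⟩

theorem arrow_hom_ext {M : Discrete V ⥤ B} {i : V} {Z : B}
    {f g : ((arrowFunctor E).obj M).obj ⟨i⟩ ⟶ Z}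
    (h : ∀ j (a : E j i), arrowι M a ≫ f = arrowι M a ≫ g) : f = g :=
  biproduct.hom_ext' _ _ fun α => h α.1 α.2

theorem arrow_hom_ext' {M : Discrete V ⥤ B} {i : V} {Z : B}
    {f g : Z ⟶ ((arrowFunctor E).obj M).obj ⟨i⟩}
    (h : ∀ j (a : E j i), f ≫ arrowπ M a = g ≫ arrowπ M a) : f = g :=
  biproduct.hom_ext _ _ fun α => h α.1 α.2

/-- The morphism out of the direct sum with given components. -/
def arrowDesc {M : Discrete V ⥤ B} {i : V} {Z : B} (f : ∀ j (_ : E j i), M.obj ⟨j⟩ ⟶ Z) :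
    ((arrowFunctor E).obj M).obj ⟨i⟩ ⟶ Z :=
  biproduct.desc fun α : Σ j, E j i => f α.1 α.2

theorem arrowι_arrowDesc {M : Discrete V ⥤ B} {i : V} {Z : B}
    (f : ∀ j (_ : E j i), M.obj ⟨j⟩ ⟶ Z) {j : V} (a : E j i) :
    arrowι M a ≫ arrowDesc f = f j a :=
  biproduct.ι_desc _ _

/-- The morphism into the direct sum with given components. -/
def arrowLift {M : Discrete V ⥤ B} {i : V} {Z : B} (f : ∀ j (_ : E j i), Z ⟶ M.obj ⟨j⟩) :
    Z ⟶ ((arrowFunctor E).obj M).obj ⟨i⟩ :=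
  biproduct.lift fun α : Σ j, E j i => f α.1 α.2

theorem arrowLift_arrowπ {M : Discrete V ⥤ B} {i : V} {Z : B}
    (f : ∀ j (_ : E j i), Z ⟶ M.obj ⟨j⟩) {j : V} (a : E j i) :
    arrowLift f ≫ arrowπ M a = f j a :=
  biproduct.lift_π _ _

theorem arrowι_map {M N : Discrete V ⥤ B} (f : M ⟶ N) {i j : V} (a : E j i) :
    arrowι M a ≫ ((arrowFunctor E).map f).app ⟨i⟩ = f.app ⟨j⟩ ≫ arrowι N a :=
  biproduct.ι_map (fun α : Σ j, E j i => f.app ⟨α.1⟩) ⟨j, a⟩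

theorem map_arrowπ {M N : Discrete V ⥤ B} (f : M ⟶ N) {i j : V} (a : E j i) :
    ((arrowFunctor E).map f).app ⟨i⟩ ≫ arrowπ N a = arrowπ M a ≫ f.app ⟨j⟩ :=
  biproduct.map_π (fun α : Σ j, E j i => f.app ⟨α.1⟩) ⟨j, a⟩

theorem isStablyZero_of_arrowι {M : Discrete V ⥤ B} {i : V} {Z : B}
    (f : ((arrowFunctor E).obj M).obj ⟨i⟩ ⟶ Z)
    (h : ∀ j (a : E j i), IsStablyZero (arrowι M a ≫ f)) : IsStablyZero f := by
  choose Y hY a b hab using h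
  refine ⟨⨁ fun α : Σ j, E j i => Y α.1 α.2, inferInstance,
    arrowDesc fun j e => a j e ≫ biproduct.ι (fun α : Σ j, E j i => Y α.1 α.2) ⟨j, e⟩,
    biproduct.desc fun α => b α.1 α.2, arrow_hom_ext fun j e => ?_⟩
  rw [hab, ← Category.assoc, arrowι_arrowDesc, Category.assoc, biproduct.ι_desc]

instance arrowFunctor_additive : (arrowFunctor (B := B) E).Additive where
  map_add {M N f g} := discrete_hom_ext fun i => arrow_hom_ext fun j a => by
    rw [NatTrans.app_add, Preadditive.comp_add, arrowι_map, arrowι_map, arrowι_map,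
      NatTrans.app_add, Preadditive.add_comp]

theorem injective_arrowFunctor_obj_app {M : Discrete V ⥤ B} {i : V}
    (h : ∀ j, E j i → Injective (M.obj ⟨j⟩)) : Injective (((arrowFunctor E).obj M).obj ⟨i⟩) := by
  have (α : Σ j, E j i) : Injective (M.obj ⟨α.1⟩) := h α.1 α.2
  exact inferInstanceAs (Injective (⨁ fun α : Σ j, E j i => M.obj ⟨α.1⟩))

instance arrowFunctor_preservesInjectiveObjects [EnoughInjectives B] :
    (arrowFunctor (B := B) E).PreservesInjectiveObjects where
  injective_obj {M} _ := injective_of_app _ fun _ => injective_arrowFunctor_obj_app fun j _ =>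
    injective_app M j

section Adjunction

variable [∀ i, Finite (Σ j, E i j)]

/-- The morphism to the sum over outgoing arrows corresponding to a morphism from the sum over
incoming arrows. -/
def arrowTranspose {M N : Discrete V ⥤ B} (f : (arrowFunctor E).obj M ⟶ N) :
    M ⟶ (arrowFunctor fun i j => E j i).obj N :=
  Discrete.natTrans fun i => arrowLift (i := i.as) fun j (a : E i.as j) => arrowι M a ≫ f.app ⟨j⟩

theorem arrowTranspose_arrowπ {M N : Discrete V ⥤ B} (f : (arrowFunctor E).obj M ⟶ N) {i j : V}
    (a : E i j) : (arrowTranspose f).app ⟨i⟩ ≫ arrowπ (E := fun i j => E j i) N a =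
      arrowι M a ≫ f.app ⟨j⟩ :=
  arrowLift_arrowπ (E := fun i j => E j i) (fun j (a : E i j) => arrowι M a ≫ f.app ⟨j⟩) a

/-- The morphism from the sum over incoming arrows corresponding to a morphism to the sum over
outgoing arrows. -/
def arrowUntranspose {M N : Discrete V ⥤ B} (g : M ⟶ (arrowFunctor fun i j => E j i).obj N) :
    (arrowFunctor E).obj M ⟶ N :=
  Discrete.natTrans fun i => arrowDesc (i := i.as) fun j (a : E j i.as) =>
    g.app ⟨j⟩ ≫ arrowπ (E := fun i j => E j i) N a

theorem arrowι_arrowUntranspose {M N : Discrete V ⥤ B}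
    (g : M ⟶ (arrowFunctor fun i j => E j i).obj N) {i j : V} (a : E j i) :
    arrowι M a ≫ (arrowUntranspose g).app ⟨i⟩ =
      g.app ⟨j⟩ ≫ arrowπ (E := fun i j => E j i) N a :=
  arrowι_arrowDesc (fun j (a : E j i) => g.app ⟨j⟩ ≫ arrowπ (E := fun i j => E j i) N a) a

variable (E) in
/-- Summing over incoming arrows is left adjoint to summing over outgoing arrows. -/
def arrowAdjunction : arrowFunctor (B := B) E ⊣ arrowFunctor (fun i j => E j i) :=
  Adjunction.mkOfHomEquiv
    { homEquiv := fun M N =>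
        { toFun := arrowTranspose
          invFun := arrowUntranspose
          left_inv := fun f => discrete_hom_ext fun i => arrow_hom_ext fun j a => by
            rw [arrowι_arrowUntranspose, arrowTranspose_arrowπ]
          right_inv := fun g => discrete_hom_ext fun i => arrow_hom_ext' fun j a => by
            rw [arrowTranspose_arrowπ, arrowι_arrowUntranspose] }
      homEquiv_naturality_left_symm := fun {M M' N} f g => discrete_hom_ext fun i =>
        arrow_hom_ext fun j a => by
          change arrowι M a ≫ (arrowUntranspose (f ≫ g)).app ⟨i⟩ =
            arrowι M a ≫ ((arrowFunctor E).map f ≫ arrowUntranspose g).app ⟨i⟩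
          rw [arrowι_arrowUntranspose, NatTrans.comp_app, NatTrans.comp_app, ← Category.assoc,
            arrowι_map, Category.assoc, Category.assoc, arrowι_arrowUntranspose]
      homEquiv_naturality_right := fun {M N N'} f g => discrete_hom_ext fun i =>
        arrow_hom_ext' fun j a => by
          change (arrowTranspose (f ≫ g)).app ⟨i⟩ ≫ arrowπ (E := fun i j => E j i) N' a =
            (arrowTranspose f ≫ (arrowFunctor fun i j => E j i).map g).app ⟨i⟩ ≫
              arrowπ (E := fun i j => E j i) N' a
          rw [arrowTranspose_arrowπ, NatTrans.comp_app, NatTrans.comp_app, Category.assoc,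
            map_arrowπ, ← Category.assoc, ← Category.assoc, arrowTranspose_arrowπ] }

end Adjunction

/-- Finite sums over incoming arrows are also products, so the functor is adjoint on both sides to
the one for the reversed arrows; this yields exactness here and in the next instance. -/
instance arrowFunctor_preservesFiniteColimits [∀ i, Finite (Σ j, E i j)] :
    PreservesFiniteColimits (arrowFunctor (B := B) E) :=
  have := (arrowAdjunction (B := B) E).leftAdjoint_preservesColimits
  inferInstance

instance arrowFunctor_preservesFiniteLimits [∀ i, Finite (Σ j, E i j)] :
    PreservesFiniteLimits (arrowFunctor (B := B) E) :=
  have := (arrowAdjunction (B := B) fun i j => E j i).rightAdjoint_preservesLimits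
  inferInstance

theorem isZero_arrowFunctor_obj_app {M : Discrete V ⥤ B} {i : V}
    (h : ∀ j, E j i → IsZero (M.obj ⟨j⟩)) : IsZero (((arrowFunctor E).obj M).obj ⟨i⟩) := by
  rw [IsZero.iff_id_eq_zero]
  exact arrow_hom_ext fun j a => (h j a).eq_of_src _ _

end ArrowFunctor

/-! ### Representations of quivers -/

section Quiver

variable {V : Type u₁} [Quiver.{v₁ + 1} V]

theorem wellFounded_of_isAcyclicQuiver [Finite V] (hV : IsAcyclicQuiver V) :
    WellFounded fun i j : V => ∃ p : Quiver.Path i j, 0 < p.length := by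
  have : IsTrans V fun i j : V => ∃ p : Quiver.Path i j, 0 < p.length :=
    ⟨fun _ _ _ ⟨p, hp⟩ ⟨q, _⟩ => ⟨p.comp q, by rw [Quiver.Path.length_comp]; omega⟩⟩
  have : Std.Irrefl fun i j : V => ∃ p : Quiver.Path i j, 0 < p.length :=
    ⟨fun i ⟨p, hp⟩ => by
      rw [hV i p] at hp
      exact lt_irrefl 0 hp⟩
  exact Finite.wellFounded_of_trans_of_irrefl _

variable [Finite V] [∀ i j : V, Finite (i ⟶ j)] (B : Type u) [Category.{v} B] [Abelian B]

variable (V) in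
/-- The endofunctor of the category of families whose algebras are the representations of `V`. -/
abbrev quiverFunctor : (Discrete V ⥤ B) ⥤ (Discrete V ⥤ B) :=
  arrowFunctor fun j i => j ⟶ i

/-- The component at `i` of the `n`-th power is a sum over paths of length `n` ending at `i`.
Induction along reachability bounds these lengths, uniformly since there are finitely many incoming
arrows and vertices. -/
theorem locallyNilpotent_quiverFunctor (hV : IsAcyclicQuiver V) :
    LocallyNilpotent (quiverFunctor V B) := by
  have key (i : V) : ∃ n, ∀ m, n ≤ m → ∀ M : Discrete V ⥤ B,
      IsZero (((iter (quiverFunctor V B) m).obj M).obj ⟨i⟩) := by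
    induction i using (wellFounded_of_isAcyclicQuiver hV).induction with
    | _ i ih =>
      have h (α : Σ j, j ⟶ i) := ih α.1 ⟨α.2.toPath, Nat.zero_lt_one⟩
      choose n hn using h
      obtain ⟨N, hN⟩ := Finite.exists_le n
      refine ⟨N + 1, fun m hm M => ?_⟩
      obtain ⟨m, rfl⟩ : ∃ k, m = k + 1 := ⟨m - 1, by omega⟩
      exact isZero_arrowFunctor_obj_app fun j a =>
        hn ⟨j, a⟩ m ((hN _).trans (Nat.le_of_succ_le_succ hm)) M
  choose n hn using key
  obtain ⟨N, hN⟩ := Finite.exists_le n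
  exact ⟨fun M => ⟨N, Functor.isZero _ fun i => hn i.as N (hN _) M⟩⟩

attribute [local instance] Abelian.hasFiniteBiproducts

variable {B} in
/-- The family of objects underlying a representation. -/
def repFamily (M : Rep V B) : Discrete V ⥤ B :=
  Discrete.functor fun i => M.obj ((Paths.of V).obj i)

variable {B} in
/-- The structure map of a representation as an algebra over `quiverFunctor`. -/
def repStr (M : Rep V B) : (quiverFunctor V B).obj (repFamily M) ⟶ repFamily M :=
  Discrete.natTrans fun i => incoming M i.as

variable {B} in
/-- The action of an arrow on a representation. -/
def repMap (M : Rep V B) {i j : V} (a : j ⟶ i) : (repFamily M).obj ⟨j⟩ ⟶ (repFamily M).obj ⟨i⟩ :=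
  M.map ((Paths.of V).map a)

variable {B} in
theorem arrowι_repStr (M : Rep V B) {i j : V} (a : j ⟶ i) :
    arrowι (repFamily M) a ≫ (repStr M).app ⟨i⟩ = repMap M a :=
  biproduct.ι_desc _ (⟨j, a⟩ : Σ j, j ⟶ i)

variable (V) in
/-- The category of representations of `V` as a category of algebras over `quiverFunctor`. -/
def repModel : AlgebraModel (quiverFunctor V B) (Rep V B) where
  fgt :=
    { obj := repFamily
      map := fun f => Discrete.natTrans fun i => f.app ((Paths.of V).obj i.as)
      map_id := fun _ => rfl
      map_comp := fun _ _ => rfl }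
  additive := ⟨rfl⟩
  faithful := ⟨fun {M N f g} h => NatTrans.ext (funext fun i =>
    congrArg (fun t : repFamily M ⟶ repFamily N => t.app ⟨i⟩) h)⟩
  str := repStr
  comm {M N} f := discrete_hom_ext fun i => arrow_hom_ext fun j a => by
    refine (Category.assoc _ _ _).symm.trans ?_
    refine (congrArg (· ≫ _) (arrowι_map _ a)).trans ?_
    refine (Category.assoc _ _ _).trans ?_
    refine (congrArg (_ ≫ ·) (arrowι_repStr N a)).trans ?_
    refine (f.naturality ((Paths.of V).map a)).symm.trans ?_
    exact (congrArg (· ≫ _) (arrowι_repStr M a).symm).trans (Category.assoc _ _ _)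
  exists_hom {M N} g hg := by
    refine ⟨Paths.liftNatTrans (F := M) (G := N) (fun i => g.app ⟨i⟩) fun {j i} a => ?_, rfl⟩
    have h := congrArg (fun t : _ ⟶ repFamily N => arrowι (repFamily M) a ≫ t.app ⟨i⟩) hg
    refine (congrArg (· ≫ _) (arrowι_repStr M a).symm).trans ?_
    refine (Category.assoc _ _ _).trans (h.symm.trans ?_)
    refine (Category.assoc _ _ _).symm.trans ?_
    refine (congrArg (· ≫ _) (arrowι_map g a)).trans ?_
    exact (Category.assoc _ _ _).trans (congrArg (_ ≫ ·) (arrowι_repStr N a))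
  exists_obj {M} u := by
    let φ : V ⥤q B :=
      { obj := fun i => M.obj ⟨i⟩
        map := fun {j i} a => arrowι M a ≫ u.app ⟨i⟩ }
    let e : repFamily (Paths.lift φ) ≅ M := Discrete.natIso fun i => Iso.refl (M.obj i)
    refine ⟨Paths.lift φ, e, discrete_hom_ext fun i => arrow_hom_ext fun j a => ?_⟩
    refine (Category.assoc _ _ _).symm.trans ?_
    refine (congrArg (· ≫ _) (arrowι_map e.hom a)).trans ?_
    refine Eq.trans ?_ (Category.assoc _ _ _)
    refine Eq.trans ?_ (congrArg (· ≫ _) (arrowι_repStr (Paths.lift φ) a)).symm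
    refine Eq.trans ?_ (congrArg (· ≫ _) (Paths.lift_toPath φ a)).symm
    refine Eq.trans ?_ (Category.comp_id _).symm
    exact (congrArg (· ≫ u.app ⟨i⟩) (Category.id_comp (arrowι M a)))

theorem monoRep_iff (M : Rep V B) : monoRep V B M ↔ Mono (repStr M) := by
  rw [NatTrans.mono_iff_mono_app]
  exact ⟨fun h i => h i.as, fun h i => h ⟨i⟩⟩

variable [EnoughInjectives B]

/-- Stable vanishing is tested on vertices and on summands, so the defect of `f` is stably zero
exactly when all arrow squares commute in the stable category. -/
theorem isStablyZero_repStr_iff {M : Discrete V ⥤ B} (u : (quiverFunctor V B).obj M ⟶ M)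
    (N : Rep V B) (f : M ⟶ repFamily N) :
    IsStablyZero ((quiverFunctor V B).map f ≫ repStr N - u ≫ f) ↔ ∀ (j i : V) (a : j ⟶ i),
      IsStablyZero (f.app ⟨j⟩ ≫ repMap N a - (arrowι M a ≫ u.app ⟨i⟩) ≫
        f.app ⟨i⟩) := by
  have key (j i : V) (a : j ⟶ i) :
      arrowι M a ≫ ((quiverFunctor V B).map f ≫ repStr N - u ≫ f).app ⟨i⟩ =
        f.app ⟨j⟩ ≫ repMap N a - (arrowι M a ≫ u.app ⟨i⟩) ≫ f.app ⟨i⟩ := by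
    rw [NatTrans.app_sub, Preadditive.comp_sub, NatTrans.comp_app, NatTrans.comp_app,
      ← Category.assoc, arrowι_map, Category.assoc, Category.assoc]
    congr 2
    exact arrowι_repStr N a
  constructor
  · intro h j i a
    exact key j i a ▸ ((isStablyZero_iff_app _).1 h i).comp_left (arrowι M a)
  · intro h
    rw [isStablyZero_iff_app]
    exact fun i => isStablyZero_of_arrowι _ fun j a => (key j i a).symm ▸ h j i a

theorem isStableModel_rep : IsStableModel (repModel V B)
    ((Functor.whiskeringRight (Paths V) B (Stable B)).obj (toStable B)) where
  map_eq_iff {M N} f g := by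
    rw [isStablyZero_iff_app]
    constructor
    · intro h i
      have := congrArg (fun t : M ⋙ toStable B ⟶ N ⋙ toStable B => t.app i) h
      exact (toStable_map_eq_iff (f.app i) (g.app i)).1 this
    · intro h
      exact NatTrans.ext (funext fun i => (toStable_map_eq_iff (f.app i) (g.app i)).2 (h i))
  exists_representative {M N} φ := by
    have h (i : V) := (toStable B).map_surjective (X := M.obj i) (Y := N.obj i) (φ.app i)
    choose f hf using h
    refine ⟨Discrete.natTrans fun i => f i.as, ?_, fun g hg => ?_⟩
    · refine (isStablyZero_repStr_iff B (repStr M) N _).2 fun j i a => ?_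
      rw [arrowι_repStr, ← toStable_map_eq_iff]
      have := φ.naturality ((Paths.of V).map a)
      exact (congrArg (· ≫ (toStable B).map (repMap N a)) (hf j)).trans
        (this.symm.trans (congrArg ((toStable B).map (repMap M a) ≫ ·) (hf i).symm))
    · rw [isStablyZero_iff_app] at hg
      exact NatTrans.ext (funext fun i =>
        ((toStable_map_eq_iff (g.app i) (f i)).2 (hg i)).trans (hf i))
  exists_structure d := by
    -- The path category is free, so representatives of the arrows can be chosen independently.
    have h (j i : V) (a : j ⟶ i) := (toStable B).map_surjective
      (X := (d.obj ((Paths.of V).obj j)).as) (Y := (d.obj ((Paths.of V).obj i)).as)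
      (d.map ((Paths.of V).map a))
    choose r hr using h
    let M : Discrete V ⥤ B := Discrete.functor fun i => (d.obj ((Paths.of V).obj i)).as
    let u : (quiverFunctor V B).obj M ⟶ M := Discrete.natTrans fun i =>
      arrowDesc (i := i.as) fun j a => r j i.as a
    have hu (j i : V) (a : j ⟶ i) : arrowι M a ≫ u.app ⟨i⟩ = r j i a :=
      arrowι_arrowDesc (E := fun j i : V => j ⟶ i) (M := M) (Z := M.obj ⟨i⟩)
        (fun j a => r j i a) a
    refine ⟨M, u, fun N w w' h₁ h₂ h₃ => ⟨Iso.symm ?_⟩⟩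
    rw [isStablyZero_iff_app] at h₂
    replace h₃ := (isStablyZero_repStr_iff B u N w).1 h₃
    refine Paths.liftNatIso (F := d) (G := N ⋙ toStable B) (fun i =>
      { hom := (toStable B).map (X := (d.obj i).as) (Y := N.obj i) (w.app ⟨i⟩)
        inv := (toStable B).map (X := N.obj i) (Y := (d.obj i).as) (w'.app ⟨i⟩)
        hom_inv_id := congrArg (fun t : M ⟶ M => (toStable B).map (t.app ⟨i⟩)) h₁
        inv_hom_id := (toStable_map_eq_iff (w'.app ⟨i⟩ ≫ w.app ⟨i⟩) (𝟙 (N.obj i))).2 (h₂ i) })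
      fun {j i} a => ?_
    have := h₃ j i a
    rw [hu, ← toStable_map_eq_iff] at this
    refine Eq.trans ?_ this.symm
    exact congrArg (· ≫ (toStable B).map (w.app ⟨i⟩)) (hr j i a).symm

/-- For an arrow `j ⟶ i`, a cosyzygy in `B`, viewed as a constant family, is a retract of the
component at `i` of the functor's value. Without arrows the functor is zero and the condition is
empty. -/
theorem isHereditary_iff_quiverFunctor (hV : ∃ i j : V, Nonempty (i ⟶ j)) :
    (∀ S : ShortComplex (Discrete V ⥤ B), S.ShortExact → Injective S.X₂ →
      Injective ((quiverFunctor V B).obj S.X₃)) ↔ IsHereditary B := by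
  constructor
  · obtain ⟨j, i, ⟨a⟩⟩ := hV
    intro h S hS hI
    have h' := h (S.map (Functor.const (Discrete V))) (hS.map_of_exact _)
      (injective_of_app _ fun _ => hI)
    have := injective_app ((quiverFunctor V B).obj ((Functor.const (Discrete V)).obj S.X₃))
      (h := h') i
    exact Retract.injective ⟨_, _, arrowι_arrowπ_self ((Functor.const (Discrete V)).obj S.X₃) a⟩
  · intro h S hS hI
    refine injective_of_app _ fun i => injective_arrowFunctor_obj_app fun j _ => ?_
    exact h (S.map ((evaluation (Discrete V) B).obj ⟨j⟩)) (hS.map_of_exact _) (injective_app S.X₂ j)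

theorem exists_isEpivalence_monoRepToStable (hV : IsAcyclicQuiver V) :
    ∃ h : Descends (exactInjective (monoRep V B)) (monoRepToStable V B),
      IsEpivalence (descend h) ∧ ((∃ i j : V, Nonempty (i ⟶ j)) →
        ((descend h).IsEquivalence ↔ IsHereditary B)) := by
  have := locallyNilpotent_quiverFunctor B hV
  obtain ⟨h, he, hi⟩ := exists_isEpivalence_descend (repModel V B) (P := monoRep V B)
    (monoRep_iff B) (isStableModel_rep B)
  exact ⟨h, he, fun hV => hi.trans (isHereditary_iff_quiverFunctor B hV)⟩

end Quiver

end StableMono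

end

theorem theoremA :
    -- representations of a finite acyclic quiver `V` in an abelian category `B`
    (∀ (V : Type u₁) [Quiver.{v₁ + 1} V] [Finite V] [∀ i j : V, Finite (i ⟶ j)]
      (B : Type u) [Category.{v} B] [Abelian B] [EnoughInjectives B],
      StableMono.IsAcyclicQuiver V →
      ∃ h : StableMono.Descends (StableMono.exactInjective (StableMono.monoRep V B))
          (StableMono.monoRepToStable V B),
        StableMono.IsEpivalence (StableMono.descend h) ∧
        ((∃ i j : V, Nonempty (i ⟶ j)) →
          ((StableMono.descend h).IsEquivalence ↔ StableMono.IsHereditary B))) ∧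
    -- modules over the free monad of an endofunctor `X` of an abelian category `C`
    (∀ (C : Type u) [Category.{v} C] [Abelian C] [EnoughInjectives C]
      (X : C ⥤ C) [X.Additive] [PreservesFiniteLimits X] [PreservesFiniteColimits X]
      [StableMono.LocallyNilpotent X] [X.PreservesInjectiveObjects],
      ∃ h : StableMono.Descends (StableMono.exactInjective (StableMono.monoProp X))
          (StableMono.monoToStable X),
        StableMono.IsEpivalence (StableMono.descend h) ∧
        ((StableMono.descend h).IsEquivalence ↔
          ∀ M : C, HasInjectiveDimensionLE (X.obj M) 1) ∧
        (StableMono.IsHereditary C → (StableMono.descend h).IsEquivalence)) := by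
  refine ⟨fun V _ _ _ B _ _ _ hV => StableMono.exists_isEpivalence_monoRepToStable B hV, ?_⟩
  exact fun C _ _ _ X _ _ _ _ _ => StableMono.exists_isEpivalence_monoToStable X
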